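/- Let $d\ge 1$ and $0\le n<N$ be integers, and let $\mathcal C\subset\mathbb Z^d$ be the union of the half-spaces $\{x_1\ge n\}$ and $\{x_1\le -n\}$ and the channel $\{|x_i|\le n,\ i=1,\dots,d\}$. Put $\Lambda_{M}=\mathcal C\cap[-M,M]^d$, $\Lambda=\Lambda_N$ and $S=\Lambda_{N+1}\setminus\Lambda_N$; write $x\sim y$ if $x,y\in\mathcal C$ are nearest neighbours. Let $\Delta\subseteq S$, $\sigma:\Delta\to\mathbb R$ and $\beta>0$ be arbitrary, and let $H(\phi)=\frac12\sum_{x}\phi_x^2$ be the quadratic Hamiltonian. **Diffusion.** Let $B_{\{x,y\}}$ be independent standard Brownian motions indexed by the bonds $\{x,y\}$, $x\sim y$, of $\mathcal C$, and put $w_{x,y}=B_{\{x,y\}}$ if $x<y$ lexicographically, $w_{x,y}=-B_{\{x,y\}}$ if $x>y$. For $\phi\in\mathbb R^{\Lambda}$ let $\phi^N(t)$ be the continuous solution started at $\phi$ of $$\phi^N_x(t)=\phi_x-\int_0^t\Big[\sum_{y\in\Lambda,\,y\sim x}\Big(\frac{\partial H}{\partial\phi_x}-\frac{\partial H}{\partial\phi_y}\Big)(\phi^N(s))+\sum_{y\in\Delta,\,y\sim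 x}\Big(\frac{\partial H}{\partial\phi_x}(\phi^N(s))-\sigma_y\Big)\Big]ds+\sqrt{2/\beta}\sum_{y\in\Lambda\cup\Delta,\,y\sim x}w_{x,y}(t),\quad x\in\Lambda,$$ that is, the Ornstein–Uhlenbeck diffusion with generator $$L=\sum_{\{x,y\}\subset\Lambda,\,x\sim y}\Big[-(\phi_x-\phi_y)(\partial_x-\partial_y)+\tfrac1\beta(\partial_x-\partial_y)^2\Big]+\sum_{x\in\Lambda}\sum_{y\in\Delta,\,y\sim x}\Big[-(\phi_x-\sigma_y)\partial_x+\tfrac1\beta\partial_x^2\Big].$$ Let $E_\phi$ denote the corresponding expectation. **Dual process.** Let $\eta^N(t)$ be the Markov jump process on $\mathbb N^{\Lambda\cup\Delta}$ ($\mathbb N=\{0,1,\dots\}$) with generator $$\mathcal Lf(\eta)=\sum_{\{x,y\}\subset\Lambda,\,x\sim y}\Big[\eta_x\big(f(\eta^{x,y})-f(\eta)\big)+\eta_y\big(f(\eta^{y,x})-f(\eta)\big)\Big]+\sum_{x\in\Lambda}\sum_{y\in\Delta,\,y\sim x}\eta_x\big(f(\eta^{x,y})-f(\eta)\big),$$ where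 $\eta^{x,y}$ is $\eta$ with one particle moved from $x$ to $y$: independent random walkers on $\Lambda$, jumping at rate $1$ to each neighbour in $\Lambda\cup\Delta$ and absorbed at $\Delta$. Let $\mathcal E_\eta$ denote the expectation for this process started at $\eta$. **Duality function.** For $\phi\in\mathbb R^\Lambda$ and $\eta\in\mathbb N^{\Lambda\cup\Delta}$ let $$D(\phi,\eta)=\prod_{y\in\Delta}\sigma_y^{\eta_y}\prod_{x\in\Lambda}h_{\eta_x}(\phi_x),\qquad h_k(\xi)=\beta^{-k/2}\,\mathrm{He}_k(\sqrt\beta\,\xi),$$ where $\mathrm{He}_k$ is the $k$-th probabilists' Hermite polynomial ($\mathrm{He}_0=1$, $\mathrm{He}_{k+1}(\xi)=\xi\,\mathrm{He}_k(\xi)-\mathrm{He}_k'(\xi)$); so $h_k$ is the monic Hermite polynomial of degree $k$ for the Gaussian $N(0,1/\beta)$, and $h_k=\mathrm{He}_k$ if $\beta=1$. **Theorem.** For all $\phi\in\mathbb R^{\Lambda}$, $\eta\in\mathbb N^{\Lambda\cup\Delta}$ and $t\ge 0$, the random variables $D(\phi^N(t),\eta)$ and $D(\phi,\eta^N(t))$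 are integrable and $$E_\phi\big[D(\phi^N(t),\eta)\big]=\mathcal E_\eta\big[D(\phi,\eta^N(t))\big].$$ -/

import Mathlib

open MeasureTheory ProbabilityTheory Filter Topology
open scoped NNReal

namespace GinzburgLandau

noncomputable section

/-! ### Geometry -/

/-- Points of the lattice `ℤ^d`. -/
abbrev Site (d : ℕ) : Type := Fin d → ℤ

/-- Two half-spaces joined by a channel: `ℤ^d_{n,+} ∪ C_n ∪ ℤ^d_{-n,-}`. -/
def domain (d n : ℕ) [NeZero d] : Set (Site d) :=
  {x | (n : ℤ) ≤ x 0} ∪ {x | ∀ i, |x i| ≤ (n : ℤ)} ∪ {x | x 0 ≤ -(n : ℤ)}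

open Classical in
/-- The finite volume `Λ_{n,N}`: the part of the domain in `[-N, N]^d`. -/
def box (d n N : ℕ) [NeZero d] : Finset (Site d) :=
  (Finset.Icc (fun _ => -(N : ℤ)) (fun _ => (N : ℤ))).filter (fun x => x ∈ domain d n)

/-- `S_{n,N} = Λ_{n,N+1} \ Λ_{n,N}`. -/
def shell (d n N : ℕ) [NeZero d] : Finset (Site d) :=
  box d n (N + 1) \ box d n N

/-- Nearest neighbours in `ℤ^d`. -/
def Nbr {d : ℕ} (x y : Site d) : Prop := ∑ i, |x i - y i| = 1

/-- Strict lexicographic order on sites. -/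
def LexLt {d : ℕ} (x y : Site d) : Prop := toLex x < toLex y

/-- Nearest neighbour bonds of the domain; the end points are listed in lexicographic order. -/
def Bond (d n : ℕ) [NeZero d] : Type :=
  {p : Site d × Site d // p.1 ∈ domain d n ∧ p.2 ∈ domain d n ∧ Nbr p.1 p.2 ∧ LexLt p.1 p.2}

/-! ### The diffusion -/

/-- Partial derivative `∂F/∂φ_x`. -/
def partialDeriv {V : Type*} [DecidableEq V] (F : (V → ℝ) → ℝ) (x : V) (φ : V → ℝ) : ℝ :=
  deriv (fun u => F (Function.update φ x u)) (φ x)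

/-- The quadratic Hamiltonian `H(φ) = (1/2) ∑_x φ_x^2` of the charges in a finite volume. -/
def quadraticH {V : Type*} [Fintype V] (φ : V → ℝ) : ℝ := (1 / 2) * ∑ x, φ x ^ 2

/-- Independent standard Brownian motions attached to the bonds of the domain. -/
structure IsBondNoise {d n : ℕ} [NeZero d] {Ω : Type*} [MeasurableSpace Ω]
    (P : Measure Ω) (B : Bond d n → ℝ≥0 → Ω → ℝ) : Prop where
  measurable : ∀ b t, Measurable (B b t)
  brownian : ∀ b, IsBrownianReal (B b) P
  indep : iIndepFun (fun (b : Bond d n) (ω : Ω) (t : ℝ≥0) => B b t ω) P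

open Classical in
/-- The antisymmetric noise `w_{x,y}`: it is `B_{x,y}` if `x < y` and `-B_{y,x}` if `y < x`. -/
def bondNoise {d n : ℕ} [NeZero d] {Ω : Type*} (B : Bond d n → ℝ≥0 → Ω → ℝ)
    (x y : Site d) (t : ℝ≥0) (ω : Ω) : ℝ :=
  if h : x ∈ domain d n ∧ y ∈ domain d n ∧ Nbr x y ∧ LexLt x y then B ⟨(x, y), h⟩ t ω
  else if h : y ∈ domain d n ∧ x ∈ domain d n ∧ Nbr y x ∧ LexLt y x then -B ⟨(y, x), h⟩ t ω
  else 0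

open Classical in
/-- The total expected current out of `x ∈ Λ`, to the other sites of `Λ` and to the reservoirs:
`∑_{y ∈ Λ, y ∼ x} (∂H/∂φ_x - ∂H/∂φ_y) + ∑_{y ∈ Δ, y ∼ x} (∂H/∂φ_x - σ_y)`. -/
def outflow {d : ℕ} (Λ Δ : Finset (Site d)) (σ : Δ → ℝ) (H : (Λ → ℝ) → ℝ)
    (φ : Λ → ℝ) (x : Λ) : ℝ :=
  (∑ y : Λ, if Nbr x.1 y.1 then partialDeriv H x φ - partialDeriv H y φ else 0)
    + ∑ y : Δ, if Nbr x.1 y.1 then partialDeriv H x φ - σ y else 0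

open Classical in
/-- The total noise received by `x`: `∑ w_{x,y}` over the neighbours `y` of `x` in `Λ ∪ Δ`. -/
def totalNoise {d n : ℕ} [NeZero d] {Ω : Type*} (Λ Δ : Finset (Site d))
    (B : Bond d n → ℝ≥0 → Ω → ℝ) (x : Λ) (t : ℝ≥0) (ω : Ω) : ℝ :=
  (∑ y : Λ, if Nbr x.1 y.1 then bondNoise B x y t ω else 0)
    + ∑ y : Δ, if Nbr x.1 y.1 then bondNoise B x y t ω else 0

/-- `Φ` is a (continuous) solution, driven by the Brownian motions `B` and started at `φ`, of
`dφ_x = - outflow_x(φ) dt + √(2/β) ∑_{y ∼ x} dw_{x,y}`, `x ∈ Λ`. -/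
structure IsSolution {d n : ℕ} [NeZero d] {Ω : Type*} [MeasurableSpace Ω] (P : Measure Ω)
    (β : ℝ) (Λ Δ : Finset (Site d)) (σ : Δ → ℝ) (H : (Λ → ℝ) → ℝ)
    (B : Bond d n → ℝ≥0 → Ω → ℝ) (φ : Λ → ℝ) (Φ : ℝ≥0 → Ω → Λ → ℝ) : Prop where
  aemeasurable : ∀ t, AEMeasurable (Φ t) P
  continuous : ∀ᵐ ω ∂P, Continuous (fun t => Φ t ω)
  equation : ∀ᵐ ω ∂P, ∀ (t : ℝ≥0) (x : Λ),
    Φ t ω x = φ x - (∫ s in (0 : ℝ)..(t : ℝ), outflow Λ Δ σ H (Φ s.toNNReal ω) x)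
      + √(2 / β) * totalNoise Λ Δ B x t ω

/-! ### The dual process -/

/-- Particle configurations on `Λ ∪ Δ` (`Λ` and `Δ` disjoint). -/
abbrev DualConfig {d : ℕ} (Λ Δ : Finset (Site d)) : Type := (Λ ⊕ Δ) → ℕ

open Classical in
/-- `η^{x,y}`, obtained from `η` by moving a particle from `x` to `y ≠ x`. It is only used
multiplied by `η x`, so its value for `η x = 0` plays no role. -/
def move {V : Type*} (η : V → ℕ) (x y : V) : V → ℕ :=
  Function.update (Function.update η x (η x - 1)) y (η y + 1)

open Classical in
/-- The generator of independent walkers on `Λ` that jump at rate 1 to each neighbour in `Λ ∪ Δ`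
and are absorbed at `Δ`. The first sum is over unordered bonds `{x, y}` of `Λ`. -/
def dualGenerator {d : ℕ} (Λ Δ : Finset (Site d)) (f : DualConfig Λ Δ → ℝ)
    (η : DualConfig Λ Δ) : ℝ :=
  (∑ x : Λ, ∑ y : Λ, if Nbr x.1 y.1 ∧ LexLt x.1 y.1 then
      (η (.inl x) : ℝ) * (f (move η (.inl x) (.inl y)) - f η)
        + (η (.inl y) : ℝ) * (f (move η (.inl y) (.inl x)) - f η) else 0)
    + ∑ x : Λ, ∑ y : Δ, if Nbr x.1 y.1 then
      (η (.inl x) : ℝ) * (f (move η (.inl x) (.inr y)) - f η) else 0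

/-- `X` is a Markov jump process on the discrete space `S` with generator `A`, started at `a`:
it is adapted to some filtration, has right-continuous paths with left limits, and solves the
martingale problem for `A` on finitely supported functions. -/
def IsMarkovJumpProcess {S : Type*} [TopologicalSpace S] [MeasurableSpace S]
    {Ω : Type*} [mΩ : MeasurableSpace Ω] (Q : Measure Ω) (A : (S → ℝ) → S → ℝ) (a : S)
    (X : ℝ≥0 → Ω → S) : Prop :=
  (∀ᵐ ω ∂Q, X 0 ω = a) ∧
  (∀ᵐ ω ∂Q, ∀ t : ℝ≥0, ContinuousWithinAt (fun s => X s ω) (Set.Ici t) t ∧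
    ∃ l, Tendsto (fun s => X s ω) (𝓝[<] t) (𝓝 l)) ∧
  ∃ ℱ : Filtration ℝ≥0 mΩ, Adapted ℱ X ∧
    ∀ f : S → ℝ, f.support.Finite →
      Martingale (fun (t : ℝ≥0) ω => f (X t ω) - ∫ s in (0 : ℝ)..(t : ℝ), A f (X s.toNNReal ω))
        ℱ Q

/-! ### The duality function -/

/-- The monic Hermite polynomials orthogonal for the Gaussian measure `N(0, 1/β)`:
`β^{-k/2} He_k(√β ξ)`. For `β = 1` they are the probabilists' Hermite polynomials `He_k`. -/
def hermiteFn (β : ℝ) (k : ℕ) (ξ : ℝ) : ℝ :=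
  (√β)⁻¹ ^ k * Polynomial.aeval (√β * ξ) (Polynomial.hermite k)

/-- `D(φ, η) = ∏_{x ∈ Δ} σ_x^{η_x} ∏_{x ∈ Λ} h_{η_x}(φ_x)`. -/
def dualityFn {d : ℕ} (β : ℝ) (Λ Δ : Finset (Site d)) (σ : Δ → ℝ) (φ : Λ → ℝ)
    (η : DualConfig Λ Δ) : ℝ :=
  (∏ y : Δ, σ y ^ η (.inr y)) * ∏ x : Λ, hermiteFn β (η (.inl x)) (φ x)

end

end GinzburgLandau

/-! The duality is an identity between moments of complex solutions of one affine differential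
equation; neither Itô's formula nor a computation with the generator of the diffusion is used.

The Hermite polynomial `h_k(ξ)` is the average of `(ξ + i g)^k` over `g ∼ N(0, 1/β)`. Hence `D(φ,
η)` is the average over a Gaussian product vector `g` of the monomial `z^η` evaluated at `φ + i g`
on `Λ` and at `σ` on `Δ` (`dualityFn_eq_integral`).

Let `A` be the Laplacian on `Λ` killed at `Δ` and `b` the reservoir input. Independent walkers are
dual to `y' = -A y + b`: moving a particle from `v` to `w` replaces one factor `z_v` by `z_w`, so
the walkers' generator acts on monomials as the vector field of the equation does. Therefore the
expectation of `y(0)^{η(t)}` is `y(t)^η`, also for complex data (`dual_integral_monomialFn`).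
Started at `φ + i g`, the solution is `y(t) = m(t) + i E g`, where `m` is the real solution from `φ`
and `E = exp(-tA)`.

On the other side, the diffusion at time `t` is `m(t) + Z`, with `Z` a centered Gaussian vector of
covariance `(1 - E²)/β` (`hasLaw_dotProduct_solution`). The reason is that the same bond gradient
yields both the drift, `A = ∇ᵀ∇`, and the noise `∇ᵀB`. Thus `g` has the law of `Z' + E g`, where
`Z'` is a copy of `Z` independent of `g` (`map_add_linear_eq_pi`), and the average of `D` over the
diffusion is that of the monomial at `m(t) + (Z + i Z') + i E g`. The law of `Z + i Z'` is invariant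
under multiplication by unit complex numbers, so by the mean value property it drops out of any
polynomial (`integral_monomialFn_add_I_smul`). What remains is the average of the monomial at `m(t)
+ i E g`, which is the dual side. -/

namespace GinzburgLandau

/-! ### Holomorphic moments of Gaussian vectors -/

section HolomorphicMoments

open Complex

variable {V : Type*}

/-- The inclusion of `ℝ^V` into `ℂ^V`. -/
noncomputable def toComplexPi : (V → ℝ) →L[ℝ] (V → ℂ) :=
  ContinuousLinearMap.pi fun x => Complex.ofRealCLM.comp (ContinuousLinearMap.proj x)

@[simp] lemma toComplexPi_apply (a : V → ℝ) (x : V) : toComplexPi a x = (a x : ℂ) := rfl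

variable [Fintype V]

/-- The monomial `∏ z_x^{k_x}`. -/
noncomputable def monomialFn (k : V → ℕ) (z : V → ℂ) : ℂ := ∏ x, z x ^ k x

lemma norm_monomialFn_le (k : V → ℕ) (z : V → ℂ) : ‖monomialFn k z‖ ≤ ‖z‖ ^ ∑ x, k x := by
  rw [monomialFn, norm_prod, ← Finset.prod_pow_eq_pow_sum]
  refine Finset.prod_le_prod (fun _ _ => norm_nonneg _) fun x _ => ?_
  rw [norm_pow]
  exact pow_le_pow_left₀ (norm_nonneg _) (norm_le_pi_norm z x) _

lemma continuous_monomialFn (k : V → ℕ) : Continuous (monomialFn k) := by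
  unfold monomialFn; fun_prop

/-- A monomial is dominated by the norm raised to its total degree, so moments of all natural orders
suffice. This supplies the integrability for the Fubini exchanges with monomials. -/
lemma integrable_monomialFn {Ω : Type*} [MeasurableSpace Ω] {μ : Measure Ω} [IsFiniteMeasure μ]
    (k : V → ℕ) {f : Ω → V → ℂ} (hf : ∀ p : ℕ, MemLp f p μ) :
    Integrable (fun ω => monomialFn k (f ω)) μ := by
  refine Integrable.mono' (MemLp.integrable_norm_pow' (hf (∑ x, k x))) ?_
    (ae_of_all _ fun ω => norm_monomialFn_le k _)
  exact (continuous_monomialFn k).comp_aestronglyMeasurable (hf 0).1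

/-- The mean value property on the complex line through `c` in the direction `w`. -/
lemma circleAverage_monomialFn (k : V → ℕ) (c w : V → ℂ) :
    Real.circleAverage (fun l : ℂ => monomialFn k (c + l • w)) 0 1 = monomialFn k c := by
  have : Differentiable ℂ (fun l : ℂ => monomialFn k (c + l • w)) := by
    unfold monomialFn
    simp only [Pi.add_apply, Pi.smul_apply, smul_eq_mul]
    fun_prop
  rw [DiffContOnCl.circleAverage this.diffContOnCl]
  simp

lemma memLp_toComplexPi (μ : Measure (V → ℝ)) [IsGaussian μ] (p : ℕ) :
    MemLp (fun z => toComplexPi z) p μ :=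
  (toComplexPi.comp_memLp' (IsGaussian.memLp_id μ p (by simp)) :)

/-- `Z + i Z'` has the holomorphic moments of the origin if `Z`, `Z'` are independent copies of a
centered Gaussian vector. -/
theorem integral_monomialFn_add_I_smul (μ : Measure (V → ℝ)) [IsGaussian μ] (hμ : μ[id] = 0)
    (k : V → ℕ) (c : V → ℂ) :
    ∫ z, monomialFn k (c + (toComplexPi z.1 + I • toComplexPi z.2)) ∂(μ.prod μ) =
      monomialFn k c := by
  have hmem : ∀ p : ℕ, MemLp (fun z : (V → ℝ) × (V → ℝ) =>
      toComplexPi z.1 + I • toComplexPi z.2) p (μ.prod μ) := fun p =>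
    ((memLp_toComplexPi μ p).comp_fst μ).add (((memLp_toComplexPi μ p).comp_snd μ).const_smul I)
  -- Multiplying `Z + i Z'` by `exp(iθ)` rotates the pair `(Z, Z')`, which preserves its law; the
  -- angle `-θ` below comes from the sign convention of `ContinuousLinearMap.rotation`. Averaging
  -- over `θ` then brings in the mean value property.
  have hrot : ∀ θ : ℝ, ∫ z, monomialFn k (c + circleMap 0 1 θ •
      (toComplexPi z.1 + I • toComplexPi z.2)) ∂(μ.prod μ) =
      ∫ z, monomialFn k (c + (toComplexPi z.1 + I • toComplexPi z.2)) ∂(μ.prod μ) := by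
    intro θ
    conv_rhs => rw [← IsGaussian.map_rotation_eq_self hμ (-θ)]
    rw [integral_map (by fun_prop)]
    · refine integral_congr_ae (ae_of_all _ fun z => ?_)
      simp only
      congr 2
      ext x
      simp only [circleMap, ContinuousLinearMap.rotation_apply, Pi.smul_apply, Pi.add_apply,
        toComplexPi_apply, smul_eq_mul, Complex.exp_mul_I]
      push_cast [Complex.cos_neg, Complex.sin_neg, Real.cos_neg, Real.sin_neg]
      linear_combination (Complex.sin θ * (z.2 x : ℂ)) * Complex.I_mul_I
    · exact ((continuous_monomialFn k).comp (by fun_prop)).aestronglyMeasurable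
  have hint : Integrable (Function.uncurry fun (θ : ℝ) (z : (V → ℝ) × (V → ℝ)) =>
      monomialFn k (c + circleMap 0 1 θ • (toComplexPi z.1 + I • toComplexPi z.2)))
      ((volume.restrict (Set.uIoc 0 (2 * Real.pi))).prod (μ.prod μ)) := by
    have : IsFiniteMeasure (volume.restrict (Set.uIoc 0 (2 * Real.pi))) := by
      rw [Set.uIoc]; infer_instance
    refine integrable_monomialFn k fun p => (memLp_const c).add ?_
    have h2 := (hmem p).comp_snd (volume.restrict (Set.uIoc 0 (2 * Real.pi)))
    refine h2.of_le ?_ (ae_of_all _ fun z => ?_)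
    · exact (((continuous_circleMap 0 1).comp continuous_fst).aestronglyMeasurable).smul h2.1
    · simp [norm_smul, -smul_add]
  calc ∫ z, monomialFn k (c + (toComplexPi z.1 + I • toComplexPi z.2)) ∂(μ.prod μ)
      = (2 * Real.pi)⁻¹ • ∫ θ in (0 : ℝ)..(2 * Real.pi),
          ∫ z, monomialFn k (c + circleMap 0 1 θ • (toComplexPi z.1 + I • toComplexPi z.2))
            ∂(μ.prod μ) := by
        simp_rw [hrot]
        rw [intervalIntegral.integral_const, smul_smul, sub_zero,
          inv_mul_cancel₀ (by positivity), one_smul]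
    _ = ∫ z, Real.circleAverage (fun l : ℂ => monomialFn k
          (c + l • (toComplexPi z.1 + I • toComplexPi z.2))) 0 1 ∂(μ.prod μ) := by
        rw [intervalIntegral_integral_swap hint, ← integral_smul]
        rfl
    _ = monomialFn k c := by
        simp_rw [circleAverage_monomialFn]
        simp

end HolomorphicMoments

/-! ### Hermite polynomials as Gaussian averages -/

section Hermite

open Complex Polynomial

/-- The Appell property. It removes the derivative from `hermite_succ` and leaves a three-term
recursion, which the Gaussian averages can be shown to satisfy as well. -/
lemma derivative_hermite_succ (k : ℕ) :
    derivative (hermite (k + 1)) = (k + 1 : ℤ[X]) * hermite k := by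
  induction k with
  | zero => simp
  | succ k ih =>
    rw [hermite_succ (k + 1), derivative_sub, derivative_mul, ih, derivative_mul, derivative_X]
    have : derivative ((k + 1 : ℤ[X])) = 0 := by simp
    rw [this, hermite_succ k]
    push_cast
    ring

lemma hermite_add_two (k : ℕ) :
    hermite (k + 2) = X * hermite (k + 1) - (k + 1 : ℤ[X]) * hermite k := by
  rw [hermite_succ, derivative_hermite_succ]

lemma hermiteFn_add_two {β : ℝ} (hβ : 0 < β) (k : ℕ) (ξ : ℝ) :
    hermiteFn β (k + 2) ξ = ξ * hermiteFn β (k + 1) ξ - (k + 1) * β⁻¹ * hermiteFn β k ξ := by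
  have hs : √β * √β = β := Real.mul_self_sqrt hβ.le
  have h0 : √β ≠ 0 := (Real.sqrt_pos.2 hβ).ne'
  have hi : β⁻¹ = (√β)⁻¹ * (√β)⁻¹ := by rw [← mul_inv, hs]
  simp only [hermiteFn, hermite_add_two, map_sub, map_mul, aeval_X, map_add, map_one, map_natCast]
  rw [hi, pow_succ, pow_succ]
  field_simp

lemma memLp_const_add_I_mul (v : ℝ≥0) (ξ : ℝ) (p : ℕ) :
    MemLp (fun g : ℝ => (ξ : ℂ) + I * g) p (gaussianReal 0 v) := by
  have h : MemLp (fun g : ℝ => (g : ℂ)) p (gaussianReal 0 v) :=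
    (memLp_id_gaussianReal' p (by simp)).ofReal
  exact (memLp_const (ξ : ℂ)).add (h.const_mul I)

lemma integrable_pow_const_add_I_mul (v : ℝ≥0) (ξ : ℝ) (k : ℕ) :
    Integrable (fun g : ℝ => ((ξ : ℂ) + I * g) ^ k) (gaussianReal 0 v) := by
  refine Integrable.mono' (MemLp.integrable_norm_pow' (memLp_const_add_I_mul v ξ k))
    (by fun_prop) (ae_of_all _ fun g => by simp)

/-- Stein's identity: the logarithmic derivative of the density is `-x/v`, and the derivative of
density times `f` integrates to zero. -/
lemma integral_id_mul_gaussianReal {v : ℝ≥0} (hv : v ≠ 0) {f f' : ℝ → ℂ}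
    (hd : ∀ x, HasDerivAt f (f' x) x) (hf : Integrable f (gaussianReal 0 v))
    (hf' : Integrable f' (gaussianReal 0 v))
    (hxf : Integrable (fun x : ℝ => (x : ℂ) * f x) (gaussianReal 0 v)) :
    ∫ x : ℝ, (x : ℂ) * f x ∂(gaussianReal 0 v) = v * ∫ x, f' x ∂(gaussianReal 0 v) := by
  have hv' : (v : ℝ) ≠ 0 := by exact_mod_cast hv
  have key : ∀ {h : ℝ → ℂ}, Integrable h (gaussianReal 0 v) →
      Integrable (fun x => gaussianPDFReal 0 v x • h x) := by
    intro h hh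
    rw [gaussianReal_of_var_ne_zero _ hv, integrable_withDensity_iff_integrable_smul'
      (measurable_gaussianPDF _ _) (ae_of_all _ fun _ => gaussianPDF_lt_top)] at hh
    simpa using hh
  have hpdf : ∀ x, HasDerivAt (gaussianPDFReal 0 v) (-(x / v) * gaussianPDFReal 0 v x) x := by
    intro x
    have h1 : HasDerivAt (fun x : ℝ => -(x - 0) ^ 2 / (2 * (v : ℝ))) (-(x / v)) x := by
      have := (((hasDerivAt_id x).sub_const 0).pow 2).neg.div_const (2 * (v : ℝ))
      refine this.congr_deriv ?_
      simp
      field_simp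
    refine (h1.exp.const_mul _).congr_deriv ?_
    rw [gaussianPDFReal]
    ring
  have h0 := integral_eq_zero_of_hasDerivAt_of_integrable
    (f := fun x => gaussianPDFReal 0 v x • f x)
    (f' := fun x => gaussianPDFReal 0 v x • f' x
      - ((v : ℂ)⁻¹) * (gaussianPDFReal 0 v x • ((x : ℂ) * f x)))
    (fun x => ((hpdf x).smul (hd x)).congr_deriv (by
      simp only [Complex.real_smul]; push_cast; field_simp; ring))
    ((key hf').sub ((key hxf).const_mul _)) (key hf)
  rw [integral_sub (key hf') ((key hxf).const_mul _), integral_const_mul,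
    ← integral_gaussianReal_eq_integral_smul hv, ← integral_gaussianReal_eq_integral_smul hv,
    sub_eq_zero] at h0
  rw [h0, ← mul_assoc, mul_inv_cancel₀ (by exact_mod_cast hv'), one_mul]

/-- Hermite polynomials as Gaussian averages of complex monomials. -/
theorem hermiteFn_eq_integral {β : ℝ} (hβ : 0 < β) (k : ℕ) (ξ : ℝ) :
    (hermiteFn β k ξ : ℂ) =
      ∫ g : ℝ, ((ξ : ℂ) + I * g) ^ k ∂(gaussianReal 0 (β⁻¹).toNNReal) := by
  set v := (β⁻¹).toNNReal with hvdef
  have hv : v ≠ 0 := by simpa [hvdef] using hβ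
  have hvr : ((v : ℝ) : ℂ) = ((β⁻¹ : ℝ) : ℂ) := by
    rw [hvdef, Real.coe_toNNReal _ (inv_nonneg.2 hβ.le)]
  have hint : ∀ k : ℕ, Integrable (fun g : ℝ => (g : ℂ) * ((ξ : ℂ) + I * g) ^ k)
      (gaussianReal 0 v) := by
    intro k
    have h1 : ∀ x : ℝ, (x : ℂ) * ((ξ : ℂ) + I * x) ^ k =
        (-I) * ((ξ : ℂ) + I * x) ^ (k + 1) + (I * ξ) * ((ξ : ℂ) + I * x) ^ k := fun x => by
      rw [pow_succ]
      linear_combination ((x : ℂ) * ((ξ : ℂ) + I * x) ^ k) * Complex.I_mul_I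
    simp_rw [h1]
    exact ((integrable_pow_const_add_I_mul v ξ (k + 1)).const_mul _).add
      ((integrable_pow_const_add_I_mul v ξ k).const_mul _)
  have hstein : ∀ k : ℕ, ∫ g : ℝ, (g : ℂ) * ((ξ : ℂ) + I * g) ^ k ∂(gaussianReal 0 v) =
      v * ∫ g : ℝ, (k : ℂ) * ((ξ : ℂ) + I * g) ^ (k - 1) * I ∂(gaussianReal 0 v) := by
    intro k
    refine integral_id_mul_gaussianReal hv (fun x => ?_) (integrable_pow_const_add_I_mul v ξ k) ?_ ?_
    · have := (((Complex.ofRealCLM.hasDerivAt (x := x)).const_mul I).const_add (ξ : ℂ)).pow k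
      simpa [Function.comp_def, Pi.pow_def] using! this
    · exact ((integrable_pow_const_add_I_mul v ξ (k - 1)).const_mul _).mul_const _
    · exact hint k
  -- Stein's identity contributes a second factor `i`, hence the minus sign of the Hermite
  -- recursion. At `k = 0` the truncated exponent `k - 1` is harmless because of the factor `k`.
  have hrec : ∀ k : ℕ, ∫ g : ℝ, ((ξ : ℂ) + I * g) ^ (k + 1) ∂(gaussianReal 0 v) =
      ξ * ∫ g : ℝ, ((ξ : ℂ) + I * g) ^ k ∂(gaussianReal 0 v) -
        k * v * ∫ g : ℝ, ((ξ : ℂ) + I * g) ^ (k - 1) ∂(gaussianReal 0 v) := by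
    intro k
    have h1 : ∀ g : ℝ, ((ξ : ℂ) + I * g) ^ (k + 1) = ξ * ((ξ : ℂ) + I * g) ^ k +
        I * ((g : ℂ) * ((ξ : ℂ) + I * g) ^ k) := fun g => by rw [pow_succ]; ring
    simp_rw [h1]
    rw [integral_add ((integrable_pow_const_add_I_mul v ξ k).const_mul _) ((hint k).const_mul _),
      integral_const_mul, integral_const_mul, hstein, integral_mul_const, integral_const_mul]
    linear_combination (v * k * ∫ g : ℝ, ((ξ : ℂ) + I * g) ^ (k - 1) ∂(gaussianReal 0 v)) *
      Complex.I_mul_I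
  induction k using Nat.twoStepInduction with
  | zero => simp [hermiteFn]
  | one =>
    have := hrec 0
    have h0 : √β ≠ 0 := (Real.sqrt_pos.2 hβ).ne'
    simp only [zero_add, pow_zero, integral_const, probReal_univ, one_smul, mul_one,
      Nat.cast_zero, zero_mul, sub_zero] at this
    rw [this]
    simp [hermiteFn, h0]
  | more k ih1 ih2 =>
    have hr := hrec (k + 1)
    rw [Nat.add_sub_cancel, ← ih1, ← ih2, hvr] at hr
    rw [show k + 2 = k + 1 + 1 from rfl, hr, hermiteFn_add_two hβ]
    push_cast
    ring

/-- Products of Hermite polynomials as Gaussian averages of complex monomials. -/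
theorem prod_hermiteFn_eq_integral {V : Type*} [Fintype V] {β : ℝ} (hβ : 0 < β) (k : V → ℕ)
    (φ : V → ℝ) :
    ((∏ x, hermiteFn β (k x) (φ x) : ℝ) : ℂ) =
      ∫ g, monomialFn k (toComplexPi φ + I • toComplexPi g)
        ∂(Measure.pi fun _ : V => gaussianReal 0 (β⁻¹).toNNReal) := by
  push_cast
  simp_rw [hermiteFn_eq_integral hβ]
  exact (integral_fintype_prod_eq_prod
    (fun (x : V) (g : ℝ) => ((φ x : ℂ) + I * g) ^ k x)).symm

end Hermite

end GinzburgLandau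

namespace GinzburgLandau

/-! ### Markov jump processes with a finite invariant set of states -/

section JumpProcess

variable {S : Type*} {Ω : Type*} [mΩ : MeasurableSpace Ω] {Q : Measure Ω}

/-- A real function of a process with almost surely right-continuous paths is jointly measurable. -/
lemma aestronglyMeasurable_uncurry_of_rightContinuous [SFinite Q] {Y : ℝ≥0 → Ω → ℝ}
    (hY : ∀ t, Measurable (Y t))
    (hc : ∀ᵐ ω ∂Q, ∀ t : ℝ≥0, ContinuousWithinAt (fun s => Y s ω) (Set.Ici t) t)
    (μ : Measure ℝ) [SFinite μ] :
    AEStronglyMeasurable (fun p : ℝ × Ω => Y p.1.toNNReal p.2) (μ.prod Q) := by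
  -- The next point after `s` of the grid of mesh `1/(n+1)`. It approaches `s` from the right, where
  -- the paths are continuous, and takes countably many values, which gives joint measurability of
  -- the approximations.
  let r : ℕ → ℝ≥0 → ℝ≥0 := fun n s => (⌊((n : ℝ≥0) + 1) * s⌋₊ + 1) / ((n : ℝ≥0) + 1)
  have hr1 : ∀ n s, s ≤ r n s := fun n s => by
    rw [le_div_iff₀ (by positivity), mul_comm]
    exact (Nat.lt_floor_add_one _).le
  have hr2 : ∀ n s, r n s ≤ s + 1 / ((n : ℝ≥0) + 1) := fun n s => by
    simp only [r]
    rw [add_div]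
    gcongr
    rw [div_le_iff₀ (by positivity)]
    rw [mul_comm s]
    exact Nat.floor_le (by positivity)
  have hr : ∀ s, Tendsto (fun n => r n s) atTop (𝓝[Set.Ici s] s) := fun s => by
    refine tendsto_nhdsWithin_of_tendsto_nhds_of_eventually_within _ ?_
      (Eventually.of_forall fun n => hr1 n s)
    refine tendsto_of_tendsto_of_tendsto_of_le_of_le tendsto_const_nhds ?_
      (fun n => hr1 n s) (fun n => hr2 n s)
    simpa using tendsto_const_nhds.add (tendsto_one_div_add_atTop_nhds_zero_nat (𝕜 := ℝ≥0))
  refine aestronglyMeasurable_of_tendsto_ae atTop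
    (f := fun n (p : ℝ × Ω) => Y (r n p.1.toNNReal) p.2) (fun n => ?_) ?_
  · refine Measurable.aestronglyMeasurable ?_
    have h1 : Measurable fun q : ℕ × Ω => Y ((q.1 + 1) / ((n : ℝ≥0) + 1)) q.2 :=
      measurable_from_prod_countable_right fun j => hY ((j + 1) / ((n : ℝ≥0) + 1))
    have h2 : Measurable fun p : ℝ × Ω => (⌊((n : ℝ≥0) + 1) * p.1.toNNReal⌋₊, p.2) :=
      (Nat.measurable_floor.comp ((measurable_real_toNNReal.comp measurable_fst).const_mul _)).prodMk
        measurable_snd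
    simpa only [r, Function.comp_def] using! h1.comp h2
  · filter_upwards [Measure.quasiMeasurePreserving_snd.ae hc] with p hp
    exact (hp p.1.toNNReal).tendsto.comp (hr _)

lemma exists_bound_of_support_subset {T : Finset S} {f : S → ℝ} (hf : f.support ⊆ T) : ∃ C, ∀ s, ‖f s‖ ≤ C := by
  refine ⟨∑ s ∈ T, ‖f s‖, fun s => ?_⟩
  by_cases hs : s ∈ T
  · exact Finset.single_le_sum (f := fun s => ‖f s‖) (fun _ _ => norm_nonneg _) hs
  · rw [Function.notMem_support.1 fun h => hs (hf h), norm_zero]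
    exact Finset.sum_nonneg fun _ _ => norm_nonneg _

lemma sum_smul_single_eq_indicator [DecidableEq S] (T : Finset S) (f : S → ℝ) :
    ∑ ζ ∈ T, f ζ • (Pi.single ζ 1 : S → ℝ) = (T : Set S).indicator f := by
  ext s
  simp [Finset.sum_apply, Pi.single_apply, Set.indicator]

variable [TopologicalSpace S] [MeasurableSpace S]
variable {A : (S → ℝ) →ₗ[ℝ] (S → ℝ)} {a : S} {X : ℝ≥0 → Ω → S} {T : Finset S}

lemma IsMarkovJumpProcess.measurable (hX : IsMarkovJumpProcess Q A a X) (t : ℝ≥0) :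
    Measurable (X t) := by
  obtain ⟨-, -, ℱ, hA, -⟩ := hX
  exact (hA t).mono (ℱ.le t) le_rfl

variable [DiscreteTopology S] [DiscreteMeasurableSpace S] [IsProbabilityMeasure Q]

/-- Right-continuity of the paths gives measurability jointly in time and chance, as needed to
exchange expectation and time integral. -/
lemma IsMarkovJumpProcess.integrable_prod (hX : IsMarkovJumpProcess Q A a X) {f : S → ℝ}
    (hf : f.support ⊆ T) (μ : Measure ℝ) [IsFiniteMeasure μ] :
    Integrable (fun p : ℝ × Ω => f (X p.1.toNNReal p.2)) (μ.prod Q) := by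
  obtain ⟨C, hC⟩ := exists_bound_of_support_subset hf
  refine Integrable.of_bound ?_ C (ae_of_all _ fun p => hC _)
  refine aestronglyMeasurable_uncurry_of_rightContinuous (Y := fun t ω => f (X t ω))
    (fun t => (Measurable.of_discrete (f := f)).comp (hX.measurable t)) ?_ μ
  filter_upwards [hX.2.1] with ω hω t
  exact (continuous_of_discreteTopology (f := f)).continuousAt.comp_continuousWithinAt (hω t).1

lemma IsMarkovJumpProcess.integrable (hX : IsMarkovJumpProcess Q A a X) {f : S → ℝ}
    (hf : f.support ⊆ T) (t : ℝ≥0) : Integrable (fun ω => f (X t ω)) Q := by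
  obtain ⟨C, hC⟩ := exists_bound_of_support_subset hf
  exact Integrable.of_bound ((Measurable.of_discrete (f := f)).comp (hX.measurable t)).aestronglyMeasurable C
    (ae_of_all _ fun p => hC _)

/-- Kolmogorov's forward equation in integrated form. -/
lemma IsMarkovJumpProcess.integral_eq (hX : IsMarkovJumpProcess Q A a X) {f : S → ℝ}
    (hf : f.support ⊆ T) (hAf : (A f).support ⊆ T) (t : ℝ≥0) :
    ∫ ω, f (X t ω) ∂Q = f a + ∫ s in (0 : ℝ)..(t : ℝ), ∫ ω, A f (X s.toNNReal ω) ∂Q := by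
  have hfin : IsFiniteMeasure (volume.restrict (Set.uIoc 0 (t : ℝ))) := by
    rw [Set.uIoc]; infer_instance
  have hprod := hX.integrable_prod hAf (volume.restrict (Set.uIoc 0 (t : ℝ)))
  have hint : Integrable (fun ω => ∫ s in (0 : ℝ)..(t : ℝ), A f (X s.toNNReal ω)) Q := by
    have := hprod.integral_prod_right
    simp_rw [intervalIntegral.integral_of_le t.coe_nonneg]
    simpa [Set.uIoc_of_le t.coe_nonneg] using this
  have hmart : ∫ ω, (f (X t ω) - ∫ s in (0 : ℝ)..(t : ℝ), A f (X s.toNNReal ω)) ∂Q = f a := by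
    obtain ⟨h0, -, ℱ, -, hM⟩ := hX
    have h := (hM f (T.finite_toSet.subset hf)).setIntegral_eq (zero_le (a := t)) MeasurableSet.univ
    simp only [Measure.restrict_univ, NNReal.coe_zero, intervalIntegral.integral_same,
      sub_zero] at h
    rw [← h]
    have : (fun ω => f (X 0 ω)) =ᵐ[Q] fun _ => f a := by
      filter_upwards [h0] with ω hω
      rw [hω]
    rw [integral_congr_ae this]
    simp
  rw [integral_sub (hX.integrable hf t) hint, sub_eq_iff_eq_add] at hmart
  rw [hmart, intervalIntegral_integral_swap hprod]

/-- The forward equation exhibits the expectation as an indefinite integral. Its continuity allows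
the integrated equation, one order lower, to be differentiated. -/
lemma IsMarkovJumpProcess.continuous_integral (hX : IsMarkovJumpProcess Q A a X) {f : S → ℝ}
    (hf : f.support ⊆ T) (hAf : (A f).support ⊆ T) :
    Continuous fun s : ℝ => ∫ ω, f (X s.toNNReal ω) ∂Q := by
  have hii : ∀ x y : ℝ, IntervalIntegrable (fun s => ∫ ω, A f (X s.toNNReal ω) ∂Q) volume x y := by
    intro x y
    rw [intervalIntegrable_iff]
    have hfin : IsFiniteMeasure (volume.restrict (Set.uIoc x y)) := by
      rw [Set.uIoc]; infer_instance
    exact (hX.integrable_prod hAf (volume.restrict (Set.uIoc x y))).integral_prod_left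
  have h : (fun s : ℝ => ∫ ω, f (X s.toNNReal ω) ∂Q) = fun s : ℝ =>
      f a + ∫ r in (0 : ℝ)..(max s 0), ∫ ω, A f (X r.toNNReal ω) ∂Q := by
    ext s
    rw [hX.integral_eq hf hAf, Real.coe_toNNReal']
  rw [h]
  exact continuous_const.add
    ((intervalIntegral.continuous_primitive hii 0).comp (continuous_id.max continuous_const))

open Classical in
/-- The process stays in a finite invariant set of states that contains its starting point. -/
lemma IsMarkovJumpProcess.ae_mem (hX : IsMarkovJumpProcess Q A a X) (ha : a ∈ T)
    (hT : A ((T : Set S).indicator 1) = 0) (t : ℝ≥0) : ∀ᵐ ω ∂Q, X t ω ∈ T := by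
  -- Since `A` kills the indicator of `T`, the probability of being in `T` keeps its initial value
  -- 1.
  have h := hX.integral_eq (T := T) (f := (T : Set S).indicator 1) Set.support_indicator_subset
    (by simp [hT]) t
  have hms : MeasurableSet {ω | X t ω ∈ T} := hX.measurable t (MeasurableSet.of_discrete (s := (T : Set S)))
  have h2 : (fun ω => (T : Set S).indicator (1 : S → ℝ) (X t ω)) =
      {ω | X t ω ∈ T}.indicator 1 := by
    ext ω; simp [Set.indicator]
  rw [h2, integral_indicator_one hms, hT] at h
  simp only [Pi.zero_apply, integral_zero, intervalIntegral.integral_zero, add_zero,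
    Set.indicator_of_mem (Finset.mem_coe.2 ha), Pi.one_apply] at h
  refine (mem_ae_iff_prob_eq_one hms).2 ?_
  rw [← ENNReal.toReal_eq_one_iff]
  exact h

/-- Expectations with respect to a process in a finite set of states are finite sums. -/
lemma IsMarkovJumpProcess.integral_comp_eq_sum {E : Type*} [NormedAddCommGroup E]
    [NormedSpace ℝ E] [CompleteSpace E] (hX : IsMarkovJumpProcess Q A a X) {t : ℝ≥0}
    (ht : ∀ᵐ ω ∂Q, X t ω ∈ T) (g : S → E) :
    Integrable (fun ω => g (X t ω)) Q ∧
      ∫ ω, g (X t ω) ∂Q = ∑ ζ ∈ T, Q.real {ω | X t ω = ζ} • g ζ := by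
  classical
  have hms : ∀ ζ, MeasurableSet {ω | X t ω = ζ} := fun ζ =>
    hX.measurable t (MeasurableSet.of_discrete (s := {ζ}))
  have hae : (fun ω => g (X t ω)) =ᵐ[Q]
      fun ω => ∑ ζ ∈ T, {ω | X t ω = ζ}.indicator (fun _ => g ζ) ω := by
    filter_upwards [ht] with ω hω
    rw [Finset.sum_eq_single_of_mem _ hω]
    · simp
    · intro b _ hb
      simp [hb.symm]
  have hint : ∀ ζ ∈ T, Integrable ({ω | X t ω = ζ}.indicator (fun _ => g ζ)) Q := fun ζ _ =>
    (integrable_const _).indicator (hms ζ)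
  refine ⟨(integrable_finsetSum T hint).congr hae.symm, ?_⟩
  rw [integral_congr_ae hae, integral_finsetSum T hint]
  exact Finset.sum_congr rfl fun ζ _ => integral_indicator_const _ (hms ζ)

/-- A solution of Kolmogorov's backward equation is the expectation of its initial value. -/
theorem IsMarkovJumpProcess.integral_eq_of_backward (hX : IsMarkovJumpProcess Q A a X)
    (ha : a ∈ T) (hA1 : A 1 = 0)
    (hT : ∀ f, A ((T : Set S).indicator f) = (T : Set S).indicator (A f))
    {u : ℝ → S → ℝ} (hu : ∀ s ζ, HasDerivAt (fun r => u r ζ) (A (u s) ζ) s) (t : ℝ≥0) :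
    ∫ ω, u 0 (X t ω) ∂Q = u t a := by
  classical
  have hmem : ∀ t, ∀ᵐ ω ∂Q, X t ω ∈ T := hX.ae_mem ha (by rw [hT, hA1]; simp)
  have hsupp : ∀ f, (A ((T : Set S).indicator f)).support ⊆ T := fun f => by
    rw [hT]; exact Set.support_indicator_subset
  have hsingle : ∀ ζ ∈ T, (T : Set S).indicator (Pi.single ζ 1 : S → ℝ) = Pi.single ζ 1 := by
    intro ζ hζ
    rw [Set.indicator_eq_self]
    exact Pi.support_single_subset.trans (by simpa using hζ)
  have hsupp1 : ∀ ζ ∈ T, (Pi.single ζ 1 : S → ℝ).support ⊆ T := fun ζ hζ => by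
    rw [← hsingle ζ hζ]; exact Set.support_indicator_subset
  have hsupp2 : ∀ ζ ∈ T, (A (Pi.single ζ 1)).support ⊆ T := fun ζ hζ => by
    rw [← hsingle ζ hζ]; exact hsupp _
  have hsupp3 : ∀ ζ ∈ T, (A (A (Pi.single ζ 1))).support ⊆ T := fun ζ hζ => by
    rw [← hsingle ζ hζ, hT]; exact hsupp _
  let p : S → ℝ → ℝ := fun ζ s => ∫ ω, (Pi.single ζ 1 : S → ℝ) (X s.toNNReal ω) ∂Q
  let q : S → ℝ → ℝ := fun ζ s => ∫ ω, A (Pi.single ζ 1) (X s.toNNReal ω) ∂Q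
  -- A differentiable extension to all real times of the probability `p` of the state `ζ`, so that
  -- two-sided derivatives exist at time 0.
  let P : S → ℝ → ℝ := fun ζ s => (Pi.single ζ 1 : S → ℝ) a + ∫ r in (0 : ℝ)..s, q ζ r
  have hPp : ∀ ζ ∈ T, ∀ s, 0 ≤ s → P ζ s = p ζ s := fun ζ hζ s hs => by
    have := hX.integral_eq (hsupp1 ζ hζ) (hsupp2 ζ hζ) s.toNNReal
    rw [Real.coe_toNNReal _ hs] at this
    exact this.symm
  have hP : ∀ ζ ∈ T, ∀ s, HasDerivAt (P ζ) (q ζ s) s := fun ζ hζ s =>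
    ((hX.continuous_integral (hsupp2 ζ hζ) (hsupp3 ζ hζ)).integral_hasStrictDerivAt
      0 s).hasDerivAt.const_add _
  -- Transposition of the generator: on `T` the function `u r` is a combination of point masses, and
  -- `A` is linear and commutes with restriction to `T`.
  have hflow : ∀ r s, ∑ ζ ∈ T, u r ζ * q ζ s = ∑ ζ ∈ T, A (u r) ζ * p ζ s := by
    intro r s
    simp only [p, q]
    simp_rw [← integral_const_mul]
    rw [← integral_finsetSum, ← integral_finsetSum]
    · congr 1
      ext ω
      have h1 := congrFun (sum_smul_single_eq_indicator T (A (u r))) (X s.toNNReal ω)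
      rw [← hT, ← sum_smul_single_eq_indicator T (u r), map_sum] at h1
      simp only [map_smul, Finset.sum_apply, Pi.smul_apply, smul_eq_mul] at h1
      exact h1.symm
    · exact fun ζ hζ => (hX.integrable (hsupp1 ζ hζ) _).const_mul _
    · exact fun ζ hζ => (hX.integrable (hsupp2 ζ hζ) _).const_mul _
  -- The expectation of `u (t - s)` at time `s`. The backward equation for `u` and the forward
  -- equation for the law cancel, so `G` is constant between its end values, the two sides of the
  -- claim.
  let G : ℝ → ℝ := fun s => ∑ ζ ∈ T, u (t - s) ζ * P ζ s
  have hG : ∀ s, 0 ≤ s → HasDerivAt G 0 s := by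
    intro s hs
    have h : HasDerivAt G (∑ ζ ∈ T, (-A (u (t - s)) ζ * P ζ s + u (t - s) ζ * q ζ s)) s := by
      refine HasDerivAt.fun_sum fun ζ hζ => HasDerivAt.fun_mul ?_ (hP ζ hζ s)
      simpa using! (hu (t - s) ζ).comp_const_sub (t : ℝ) s
    refine h.congr_deriv ?_
    rw [Finset.sum_add_distrib, hflow, ← Finset.sum_add_distrib]
    exact Finset.sum_eq_zero fun ζ hζ => by rw [hPp ζ hζ s hs]; ring
  have hGt : G t = G 0 := constant_of_has_deriv_right_zero
    (fun s hs => (hG s hs.1).continuousAt.continuousWithinAt)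
    (fun s hs => (hG s hs.1).hasDerivWithinAt) t ⟨t.2, le_rfl⟩
  have hG0 : G 0 = u t a := by
    simp only [G, P, sub_zero, intervalIntegral.integral_same, add_zero]
    rw [Finset.sum_eq_single_of_mem a ha fun b _ hb => by simp [hb.symm]]
    simp
  rw [← hG0, ← hGt, (hX.integral_comp_eq_sum (hmem t) (u 0)).2]
  refine Finset.sum_congr rfl fun ζ hζ => ?_
  rw [hPp ζ hζ t t.2, sub_self, smul_eq_mul, mul_comm]
  congr 1
  simp only [p, Real.toNNReal_coe]
  have hms : MeasurableSet {ω | X t ω = ζ} :=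
    hX.measurable t (MeasurableSet.of_discrete (s := {ζ}))
  rw [← integral_indicator_one hms]
  congr 1
  ext ω
  simp [Pi.single_apply, Set.indicator]

end JumpProcess
end GinzburgLandau

namespace GinzburgLandau

/-! ### The generator of the dual process -/

section DualGenerator

open Classical

variable {d : ℕ}

lemma nbr_comm {x y : Site d} : Nbr x y ↔ Nbr y x := by
  simp only [Nbr, abs_sub_comm]

lemma Nbr.ne {x y : Site d} (h : Nbr x y) : x ≠ y := by
  rintro rfl
  simp [Nbr] at h

lemma LexLt.asymm {x y : Site d} (h : LexLt x y) : ¬ LexLt y x := lt_asymm (α := Lex (Site d)) h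

lemma Nbr.lexLt_or {x y : Site d} (h : Nbr x y) : LexLt x y ∨ LexLt y x :=
  lt_or_gt_of_ne (α := Lex (Site d)) fun h' => h.ne (toLex.injective h')

/-- A sum over oriented bonds as a sum over unoriented ones. -/
lemma sum_lexLt_add_swap {V E : Type*} [Fintype V] [AddCommMonoid E] (ι : V → Site d)
    (g : V → V → E) :
    (∑ x, ∑ y, if Nbr (ι x) (ι y) ∧ LexLt (ι x) (ι y) then g x y + g y x else 0) =
      ∑ x, ∑ y, if Nbr (ι x) (ι y) then g x y else 0 := by
  have h : ∀ x y, (if Nbr (ι x) (ι y) then g x y else 0) =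
      (if Nbr (ι x) (ι y) ∧ LexLt (ι x) (ι y) then g x y else 0) +
        if Nbr (ι y) (ι x) ∧ LexLt (ι y) (ι x) then g x y else 0 := by
    intro x y
    by_cases h : Nbr (ι x) (ι y)
    · rcases h.lexLt_or with h' | h'
      · simp [h, h', h'.asymm]
      · simp [h, nbr_comm.1 h, h', h'.asymm]
    · simp [h, mt nbr_comm.1 h]
  simp_rw [h, Finset.sum_add_distrib]
  rw [Finset.sum_comm (f := fun x y => if Nbr (ι y) (ι x) ∧ LexLt (ι y) (ι x) then g x y else 0),
    ← Finset.sum_add_distrib]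
  refine Finset.sum_congr rfl fun x _ => ?_
  rw [← Finset.sum_add_distrib]
  refine Finset.sum_congr rfl fun y _ => ?_
  split_ifs <;> simp

variable (Λ Δ : Finset (Site d))

/-- Each unordered bond carries both jumps, so ordered pairs give the same sum and the lexicographic
order disappears. -/
lemma dualGenerator_eq (f : DualConfig Λ Δ → ℝ) (η : DualConfig Λ Δ) :
    dualGenerator Λ Δ f η =
      (∑ x : Λ, ∑ y : Λ, if Nbr x.1 y.1 then
        (η (.inl x) : ℝ) * (f (move η (.inl x) (.inl y)) - f η) else 0)
      + ∑ x : Λ, ∑ y : Δ, if Nbr x.1 y.1 then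
        (η (.inl x) : ℝ) * (f (move η (.inl x) (.inr y)) - f η) else 0 := by
  rw [dualGenerator]
  congr 1
  exact sum_lexLt_add_swap (V := Λ) (E := ℝ) (fun x : Λ => x.1)
    fun x y => (η (.inl x) : ℝ) * (f (move η (.inl x) (.inl y)) - f η)

/-- The generator of the dual process as a linear map. -/
noncomputable def dualGeneratorLinear :
    (DualConfig Λ Δ → ℝ) →ₗ[ℝ] (DualConfig Λ Δ → ℝ) where
  toFun := dualGenerator Λ Δ
  map_add' f g := by
    ext η
    simp only [dualGenerator_eq, Pi.add_apply]
    rw [add_add_add_comm]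
    congr 1 <;> rw [← Finset.sum_add_distrib] <;> refine Finset.sum_congr rfl fun x _ => ?_ <;>
      rw [← Finset.sum_add_distrib] <;> refine Finset.sum_congr rfl fun y _ => ?_ <;>
      split_ifs <;> ring
  map_smul' c f := by
    ext η
    simp only [dualGenerator_eq, Pi.smul_apply, smul_eq_mul, RingHom.id_apply, mul_add,
      Finset.mul_sum]
    congr 1 <;> refine Finset.sum_congr rfl fun x _ => Finset.sum_congr rfl fun y _ => ?_ <;>
      split_ifs <;> ring

lemma coe_dualGeneratorLinear : ⇑(dualGeneratorLinear Λ Δ) = dualGenerator Λ Δ := rfl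

lemma dualGenerator_one : dualGenerator Λ Δ 1 = 0 := by
  ext η
  simp [dualGenerator_eq]

/-- Both hypotheses matter: `move` from an empty site, or from a site to itself, would create a
particle. -/
lemma sum_move {V : Type*} [Fintype V] (η : V → ℕ) {x y : V} (hxy : x ≠ y) (hx : η x ≠ 0) :
    ∑ v, move η x y v = ∑ v, η v := by
  have h1 := Finset.sum_update_of_mem (Finset.mem_univ y) (Function.update η x (η x - 1))
    (η y + 1)
  have h2 := Finset.add_sum_erase Finset.univ (Function.update η x (η x - 1)) (Finset.mem_univ y)
  have h3 := Finset.sum_update_of_mem (Finset.mem_univ x) η (η x - 1)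
  have h4 := Finset.add_sum_erase Finset.univ η (Finset.mem_univ x)
  rw [Function.update_of_ne hxy.symm] at h2
  simp only [← Finset.erase_eq] at h1 h3
  simp only [move]
  omega

/-- The finite set of configurations with `k` particles. -/
noncomputable def configs (k : ℕ) : Finset (DualConfig Λ Δ) := Finset.piAntidiag Finset.univ k

lemma mem_configs {k : ℕ} {η : DualConfig Λ Δ} : η ∈ configs Λ Δ k ↔ ∑ v, η v = k := by
  simp [configs, Finset.mem_piAntidiag]

/-- Every move of nonzero rate conserves the number of particles. The finite sets `configs` are
therefore invariant, which makes test functions of finite support sufficient. -/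
lemma dualGenerator_indicator (k : ℕ) (f : DualConfig Λ Δ → ℝ) :
    dualGenerator Λ Δ ((configs Λ Δ k : Set (DualConfig Λ Δ)).indicator f) =
      (configs Λ Δ k : Set (DualConfig Λ Δ)).indicator (dualGenerator Λ Δ f) := by
  ext η
  have h : ∀ v w, v ≠ w → (η v : ℝ) *
      ((configs Λ Δ k : Set (DualConfig Λ Δ)).indicator f (move η v w) -
        (configs Λ Δ k : Set (DualConfig Λ Δ)).indicator f η) =
      if ∑ v, η v = k then (η v : ℝ) * (f (move η v w) - f η) else 0 := by
    intro v w hvw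
    rcases eq_or_ne (η v) 0 with h0 | h0
    · simp [h0]
    · simp only [Set.indicator, Finset.mem_coe, mem_configs, sum_move η hvw h0]
      split_ifs <;> simp
  simp only [Set.indicator_apply (s := (configs Λ Δ k : Set (DualConfig Λ Δ)))
    (f := dualGenerator Λ Δ f), Finset.mem_coe, mem_configs, dualGenerator_eq]
  have hne : ∀ {x y : Λ}, Nbr x.1 y.1 → (Sum.inl x : Λ ⊕ Δ) ≠ Sum.inl y := fun hn h' =>
    hn.ne (congrArg Subtype.val (Sum.inl.inj h'))
  by_cases hk : ∑ v, η v = k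
  · simp only [if_pos hk] at h ⊢
    congr 1 <;> refine Finset.sum_congr rfl fun x _ => Finset.sum_congr rfl fun y _ => ?_ <;>
      split_ifs with hn
    · exact h _ _ (hne hn)
    · rfl
    · exact h _ _ Sum.inl_ne_inr
    · rfl
  · simp only [if_neg hk] at h ⊢
    rw [Finset.sum_eq_zero, Finset.sum_eq_zero, add_zero] <;>
      refine fun x _ => Finset.sum_eq_zero fun y _ => ?_ <;> split_ifs with hn
    · exact h _ _ Sum.inl_ne_inr
    · rfl
    · exact h _ _ (hne hn)
    · rfl

/-- The generator of the dual process acting on complex functions. -/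
noncomputable def dualGeneratorComplex (F : DualConfig Λ Δ → ℂ) (η : DualConfig Λ Δ) : ℂ :=
  (∑ x : Λ, ∑ y : Λ, if Nbr x.1 y.1 then
      (η (.inl x) : ℝ) • (F (move η (.inl x) (.inl y)) - F η) else 0)
    + ∑ x : Λ, ∑ y : Δ, if Nbr x.1 y.1 then
      (η (.inl x) : ℝ) • (F (move η (.inl x) (.inr y)) - F η) else 0

/-- Real and imaginary parts carry complex monomials into the martingale problem, which is posed for
real functions. -/
lemma dualGenerator_comp (l : ℂ →L[ℝ] ℝ) (F : DualConfig Λ Δ → ℂ) (η : DualConfig Λ Δ) :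
    dualGenerator Λ Δ (fun ξ => l (F ξ)) η = l (dualGeneratorComplex Λ Δ F η) := by
  simp only [dualGenerator_eq, dualGeneratorComplex, map_add, map_sum, apply_ite l, map_zero,
    map_smul, map_sub, smul_eq_mul]

/-! ### Monomials under moves of particles and along the differential equation. -/

/-- The partial derivative of a monomial. -/
noncomputable def monomialDeriv {V : Type*} [Fintype V] (k : V → ℕ) (z : V → ℂ) (v : V) : ℂ :=
  (∏ u ∈ Finset.univ.erase v, z u ^ k u) * (k v * z v ^ (k v - 1))

lemma monomialFn_update {V : Type*} [Fintype V] (k : V → ℕ) (z : V → ℂ) (v : V) (j : ℕ) :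
    monomialFn (Function.update k v j) z = (∏ u ∈ Finset.univ.erase v, z u ^ k u) * z v ^ j := by
  rw [monomialFn, ← Finset.prod_erase_mul _ _ (Finset.mem_univ v)]
  congr 1
  · refine Finset.prod_congr rfl fun u hu => ?_
    rw [Function.update_of_ne (Finset.ne_of_mem_erase hu)]
  · rw [Function.update_self]

/-- The algebraic core of the duality: a jump trades one factor `z v` for `z w`, and the rate `k v`
turns the remaining product into a partial derivative. If `k v = 0` both sides vanish. -/
lemma monomialFn_move_sub {V : Type*} [Fintype V] (k : V → ℕ) (z : V → ℂ) {v w : V} (hvw : v ≠ w) :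
    (k v : ℝ) • (monomialFn (move k v w) z - monomialFn k z) =
      (z w - z v) * monomialDeriv k z v := by
  have h1 : monomialFn (move k v w) z = z w * monomialFn (Function.update k v (k v - 1)) z := by
    have hw : Function.update k v (k v - 1) w = k w := Function.update_of_ne hvw.symm _ _
    have h2 := monomialFn_update (Function.update k v (k v - 1)) z w
      (Function.update k v (k v - 1) w)
    rw [Function.update_eq_self] at h2
    rw [move, monomialFn_update, h2, hw, pow_succ]
    ring
  have h3 := monomialFn_update k z v (k v)
  rw [Function.update_eq_self] at h3
  rw [h1, monomialFn_update, h3, monomialDeriv, Complex.real_smul]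
  rcases Nat.eq_zero_or_pos (k v) with h0 | h0
  · simp [h0]
  · have : z v ^ k v = z v ^ (k v - 1) * z v := by rw [← pow_succ, Nat.sub_add_cancel h0]
    rw [this]
    push_cast
    ring

lemma hasDerivAt_monomialFn {V : Type*} [Fintype V] (k : V → ℕ) {z : ℝ → V → ℂ} {z' : V → ℂ}
    {s : ℝ} (hz : ∀ v, HasDerivAt (fun r => z r v) (z' v) s) :
    HasDerivAt (fun r => monomialFn k (z r)) (∑ v, z' v * monomialDeriv k (z s) v) s := by
  unfold monomialFn
  refine (HasDerivAt.fun_finsetProd fun v _ => (hz v).fun_pow (k v)).congr_deriv ?_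
  refine Finset.sum_congr rfl fun v _ => ?_
  rw [monomialDeriv, smul_eq_mul]
  ring

/-- Duality of independent random walks and the associated (complex) linear differential
equation. -/
theorem hasDerivAt_monomialFn_dual (σ : Δ → ℝ) {y : ℝ → Λ → ℂ} {s : ℝ}
    (hy : ∀ x : Λ, HasDerivAt (fun r => y r x)
      ((∑ w : Λ, if Nbr x.1 w.1 then y s w - y s x else 0) +
        ∑ w : Δ, if Nbr x.1 w.1 then (σ w : ℂ) - y s x else 0) s) (η : DualConfig Λ Δ) :
    HasDerivAt (fun r => monomialFn η (Sum.elim (y r) fun w => (σ w : ℂ)))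
      (dualGeneratorComplex Λ Δ
        (fun ξ => monomialFn ξ (Sum.elim (y s) fun w => (σ w : ℂ))) η) s := by
  have hz : ∀ v : Λ ⊕ Δ, HasDerivAt (fun r => (Sum.elim (y r) fun w => (σ w : ℂ)) v)
      (Sum.elim (fun x : Λ => (∑ w : Λ, if Nbr x.1 w.1 then y s w - y s x else 0) +
        ∑ w : Δ, if Nbr x.1 w.1 then (σ w : ℂ) - y s x else 0) (fun _ => 0) v) s := by
    rintro (x | w)
    · exact hy x
    · exact hasDerivAt_const _ _
  refine (hasDerivAt_monomialFn η hz).congr_deriv ?_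
  rw [Fintype.sum_sum_type]
  simp only [Sum.elim_inl, Sum.elim_inr, zero_mul, Finset.sum_const_zero, add_zero, add_mul,
    Finset.sum_add_distrib, Finset.sum_mul, dualGeneratorComplex, ite_mul]
  congr 1 <;> refine Finset.sum_congr rfl fun x _ => Finset.sum_congr rfl fun w _ => ?_ <;>
    split_ifs with h
  · rw [monomialFn_move_sub _ _ fun h' => h.ne (congrArg Subtype.val (Sum.inl.inj h'))]; simp
  · rfl
  · rw [monomialFn_move_sub _ _ Sum.inl_ne_inr]; simp
  · rfl

/-! ### Expectations under the dual process. -/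

variable {Λ Δ} {Ω : Type*} [MeasurableSpace Ω] {Q : Measure Ω} [IsProbabilityMeasure Q]
  {η : DualConfig Λ Δ} {X : ℝ≥0 → Ω → DualConfig Λ Δ}

lemma dual_ae_mem_configs (hX : IsMarkovJumpProcess Q (dualGenerator Λ Δ) η X) (t : ℝ≥0) :
    ∀ᵐ ω ∂Q, X t ω ∈ configs Λ Δ (∑ v, η v) :=
  IsMarkovJumpProcess.ae_mem (A := dualGeneratorLinear Λ Δ) hX ((mem_configs Λ Δ).2 rfl)
    (by rw [coe_dualGeneratorLinear, dualGenerator_indicator, dualGenerator_one]; simp) t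

lemma dual_integral_eq_sum {E : Type*} [NormedAddCommGroup E] [NormedSpace ℝ E] [CompleteSpace E]
    (hX : IsMarkovJumpProcess Q (dualGenerator Λ Δ) η X) (t : ℝ≥0) (g : DualConfig Λ Δ → E) :
    Integrable (fun ω => g (X t ω)) Q ∧
      ∫ ω, g (X t ω) ∂Q =
        ∑ ζ ∈ configs Λ Δ (∑ v, η v), Q.real {ω | X t ω = ζ} • g ζ :=
  IsMarkovJumpProcess.integral_comp_eq_sum (A := dualGeneratorLinear Λ Δ) hX
    (dual_ae_mem_configs hX t) g

/-- The moments of independent random walks are given by the linear differential equation. -/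
theorem dual_integral_monomialFn (hX : IsMarkovJumpProcess Q (dualGenerator Λ Δ) η X)
    (σ : Δ → ℝ) {y : ℝ → Λ → ℂ}
    (hy : ∀ s (x : Λ), HasDerivAt (fun r => y r x)
      ((∑ w : Λ, if Nbr x.1 w.1 then y s w - y s x else 0) +
        ∑ w : Δ, if Nbr x.1 w.1 then (σ w : ℂ) - y s x else 0) s) (t : ℝ≥0) :
    ∫ ω, monomialFn (X t ω) (Sum.elim (y 0) fun w => (σ w : ℂ)) ∂Q =
      monomialFn η (Sum.elim (y t) fun w => (σ w : ℂ)) := by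
  have h : ∀ l : ℂ →L[ℝ] ℝ,
      l (∫ ω, monomialFn (X t ω) (Sum.elim (y 0) fun w => (σ w : ℂ)) ∂Q) =
        l (monomialFn η (Sum.elim (y t) fun w => (σ w : ℂ))) := by
    intro l
    rw [← l.integral_comp_comm (dual_integral_eq_sum hX t
      fun ξ => monomialFn ξ (Sum.elim (y 0) fun w => (σ w : ℂ))).1]
    refine IsMarkovJumpProcess.integral_eq_of_backward (A := dualGeneratorLinear Λ Δ)
      (u := fun s ξ => l (monomialFn ξ (Sum.elim (y s) fun w => (σ w : ℂ)))) hX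
      ((mem_configs Λ Δ).2 rfl) (dualGenerator_one Λ Δ) (dualGenerator_indicator Λ Δ _) ?_ t
    intro s ζ
    rw [coe_dualGeneratorLinear, dualGenerator_comp]
    exact l.hasFDerivAt.comp_hasDerivAt s (hasDerivAt_monomialFn_dual Λ Δ σ (hy s) ζ)
  exact Complex.ext (h Complex.reCLM) (h Complex.imCLM)

end DualGenerator
end GinzburgLandau

namespace GinzburgLandau

/-! ### Wiener integrals of smooth functions -/

section Wiener

variable {Ω : Type*} [MeasurableSpace Ω] {P : Measure Ω} [IsProbabilityMeasure P]

/-- Characteristic functions converge along the almost sure limit by dominated convergence, and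
along the Gaussian laws through the variances. Used to pass from step functions to Wiener integrals.
-/
lemma hasLaw_gaussianReal_of_tendsto {Y : ℕ → Ω → ℝ} {Z : Ω → ℝ} {v : ℕ → ℝ≥0} {w : ℝ≥0}
    (hY : ∀ n, HasLaw (Y n) (gaussianReal 0 (v n)) P) (hv : Tendsto v atTop (𝓝 w))
    (hZ : ∀ᵐ ω ∂P, Tendsto (fun n => Y n ω) atTop (𝓝 (Z ω))) :
    HasLaw Z (gaussianReal 0 w) P := by
  have hm : AEMeasurable Z P :=
    aemeasurable_of_tendsto_metrizable_ae atTop (fun n => (hY n).aemeasurable) hZ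
  refine ⟨hm, ?_⟩
  have : IsProbabilityMeasure (P.map Z) := Measure.isProbabilityMeasure_map hm
  have hchar : ∀ {f : Ω → ℝ}, AEMeasurable f P → ∀ t : ℝ,
      charFun (P.map f) t = ∫ ω, Complex.exp (t * f ω * Complex.I) ∂P := by
    intro f hf t
    rw [charFun_apply_real, integral_map hf]
    exact Continuous.aestronglyMeasurable (by fun_prop)
  refine Measure.ext_of_charFun (funext fun t => ?_)
  have h1 : Tendsto (fun n => charFun (P.map (Y n)) t) atTop (𝓝 (charFun (P.map Z) t)) := by
    simp_rw [fun n => hchar (hY n).aemeasurable t, hchar hm t]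
    refine tendsto_integral_of_dominated_convergence (fun _ => 1) (fun n => ?_)
      (integrable_const _) (fun n => ae_of_all _ fun ω => ?_) ?_
    · exact (Continuous.measurable (f := fun x : ℝ => Complex.exp (t * x * Complex.I))
        (by fun_prop)).comp_aemeasurable (hY n).aemeasurable |>.aestronglyMeasurable
    · rw [← Complex.ofReal_mul, Complex.norm_exp_ofReal_mul_I]
    · filter_upwards [hZ] with ω hω
      exact (Continuous.tendsto (f := fun x : ℝ => Complex.exp (t * x * Complex.I))
        (by fun_prop) _).comp hω
  have h2 : Tendsto (fun n => charFun (P.map (Y n)) t) atTop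
      (𝓝 (charFun (gaussianReal 0 w) t)) := by
    simp_rw [fun n => (hY n).map_eq, charFun_gaussianReal]
    exact (Continuous.tendsto (f := fun x : ℝ≥0 =>
      Complex.exp (t * (0 : ℝ) * Complex.I - (x : ℝ) * t ^ 2 / 2)) (by fun_prop) w).comp hv
  exact tendsto_nhds_unique h1 h2

lemma hasLaw_gaussianReal_sum {ι : Type*} [Fintype ι] {Y : ι → Ω → ℝ} {v : ι → ℝ≥0}
    (hY : ∀ i, HasLaw (Y i) (gaussianReal 0 (v i)) P) (hind : iIndepFun Y P) :
    HasLaw (fun ω => ∑ i, Y i ω) (gaussianReal 0 (∑ i, v i)) P := by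
  have hm : AEMeasurable (fun ω => ∑ i, Y i ω) P :=
    Finset.aemeasurable_fun_sum _ fun i _ => (hY i).aemeasurable
  refine ⟨hm, ?_⟩
  have : IsProbabilityMeasure (P.map fun ω => ∑ i, Y i ω) := Measure.isProbabilityMeasure_map hm
  refine Measure.ext_of_charFun ?_
  rw [hind.charFun_map_fun_sum_eq_prod fun i => (hY i).aemeasurable]
  ext t
  simp_rw [Finset.prod_apply, fun i => (hY i).map_eq, charFun_gaussianReal, ← Complex.exp_sum]
  congr 1
  simp [Finset.sum_div, Finset.sum_mul]

omit [IsProbabilityMeasure P] in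
lemma hasLaw_gaussianReal_const_mul {Y : Ω → ℝ} {v : ℝ≥0} (hY : HasLaw Y (gaussianReal 0 v) P)
    (c : ℝ) : HasLaw (fun ω => c * Y ω) (gaussianReal 0 ((c ^ 2).toNNReal * v)) P := by
  have h : HasLaw (fun x : ℝ => c * x) (gaussianReal 0 ((c ^ 2).toNNReal * v))
      (gaussianReal 0 v) := by
    refine ⟨by fun_prop, ?_⟩
    rw [gaussianReal_map_const_mul, mul_zero]
    congr 2
    ext
    simp [Real.coe_toNNReal _ (sq_nonneg c)]
  exact h.comp hY

/-- The law of a Wiener integral of a step function. -/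
lemma hasLaw_sum_increments {B : ℝ≥0 → Ω → ℝ} (hB : IsPreBrownianReal B P) {s : ℕ → ℝ≥0}
    (hs : Monotone s) (c : ℕ → ℝ) (n : ℕ) :
    HasLaw (fun ω => ∑ j ∈ Finset.range n, c j * (B (s (j + 1)) ω - B (s j) ω))
      (gaussianReal 0 (∑ j ∈ Finset.range n, c j ^ 2 * ((s (j + 1) : ℝ) - s j)).toNNReal) P := by
  have hind := (hB.hasIndepIncrements.nat hs).comp (fun j x => c j * x) (fun j => by fun_prop)
  have hind' := hind.precomp (g := fun j : Fin n => (j : ℕ)) Fin.val_injective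
  have h := hasLaw_gaussianReal_sum (fun j : Fin n =>
    hasLaw_gaussianReal_const_mul (hB.hasLaw_sub (s (j + 1)) (s j)) (c j)) hind'
  simp_rw [Finset.sum_range]
  convert h using 2
  · simp
  refine NNReal.eq ?_
  have hd : ∀ j, 0 ≤ (s (j + 1) : ℝ) - s j := fun j =>
    sub_nonneg.2 (NNReal.coe_le_coe.2 (hs (Nat.le_succ j)))
  rw [Real.coe_toNNReal _ (Finset.sum_nonneg fun j _ => mul_nonneg (sq_nonneg _) (hd _))]
  push_cast
  refine Finset.sum_congr rfl fun j _ => ?_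
  rw [Real.coe_toNNReal _ (sq_nonneg _), Real.dist_eq]
  congr 1
  exact (abs_of_nonneg (hd j)).symm

/-- Convergence of Riemann sums along uniform partitions of `[0, t]`. -/
lemma tendsto_riemann_sum {f g : ℝ → ℝ} (hf : Continuous f) (hg : Continuous g) {t : ℝ}
    (ht : 0 ≤ t) (ξ : ℕ → ℕ → ℝ)
    (hξ : ∀ n j : ℕ, j ≤ n → ξ n j ∈ Set.Icc ((j : ℝ) / (n + 1) * t) ((j + 1 : ℝ) / (n + 1) * t)) :
    Tendsto (fun n : ℕ => ∑ j ∈ Finset.range (n + 1),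
      (∫ s in ((j : ℝ) / (n + 1) * t)..((j + 1 : ℝ) / (n + 1) * t), f s) * g (ξ n j)) atTop
      (𝓝 (∫ s in (0 : ℝ)..t, f s * g s)) := by
  obtain ⟨C, hC⟩ := (isCompact_Icc (a := (0 : ℝ)) (b := t)).exists_bound_of_continuousOn
    hf.continuousOn
  have hC0 : 0 ≤ C := (norm_nonneg _).trans (hC 0 ⟨le_rfl, ht⟩)
  have huc := (isCompact_Icc (a := (0 : ℝ)) (b := t)).uniformContinuousOn_of_continuous
    hg.continuousOn
  rw [Metric.uniformContinuousOn_iff] at huc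
  rw [Metric.tendsto_atTop]
  intro ε hε
  -- The total error is at most `C * t` times this tolerance; the added 1 keeps the denominator
  -- positive and the final bound strict.
  obtain ⟨δ, hδ, hgδ⟩ := huc (ε / (C * t + 1)) (by positivity)
  obtain ⟨M, hM⟩ := exists_nat_gt (t / δ)
  refine ⟨M, fun n hn => ?_⟩
  have hn0 : (0 : ℝ) < n + 1 := by positivity
  have hmesh : t / (n + 1) < δ := by
    rw [div_lt_iff₀ hn0]
    rw [div_lt_iff₀ hδ] at hM
    have : (M : ℝ) ≤ n := by exact_mod_cast hn
    nlinarith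
  let s : ℕ → ℝ := fun j => (j : ℝ) / (n + 1) * t
  have hs : ∀ j : ℕ, (j + 1 : ℝ) / (n + 1) * t = s (j + 1) := fun j => by simp [s]
  have hstep : ∀ j, s (j + 1) - s j = t / (n + 1) := fun j => by simp only [s]; push_cast; ring
  have hs0 : s 0 = 0 := by simp [s]
  have hsn : s (n + 1) = t := by simp only [s]; push_cast; rw [div_self hn0.ne', one_mul]
  have hmono : Monotone s := monotone_nat_of_le_succ fun j => by
    have := hstep j
    have : 0 ≤ t / (n + 1) := by positivity
    linarith
  have hsum : ∫ x in (0 : ℝ)..t, f x * g x =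
      ∑ j ∈ Finset.range (n + 1), ∫ x in (s j)..(s (j + 1)), f x * g x := by
    rw [intervalIntegral.sum_integral_adjacent_intervals
      (f := fun x => f x * g x) (fun k _ => (hf.mul hg).intervalIntegrable _ _), hs0, hsn]
  have hbound : ∀ j ∈ Finset.range (n + 1),
      ‖(∫ x in (s j)..(s (j + 1)), f x) * g (ξ n j) - ∫ x in (s j)..(s (j + 1)), f x * g x‖ ≤
        C * (ε / (C * t + 1)) * (t / (n + 1)) := by
    intro j hj
    have hjn : j + 1 ≤ n + 1 := Finset.mem_range.1 hj
    rw [← intervalIntegral.integral_mul_const, ← intervalIntegral.integral_sub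
      (f := fun x => f x * g (ξ n j)) (g := fun x => f x * g x)
      ((hf.mul continuous_const).intervalIntegrable _ _) ((hf.mul hg).intervalIntegrable _ _)]
    refine (intervalIntegral.norm_integral_le_of_norm_le_const
      (C := C * (ε / (C * t + 1))) fun x hx => ?_).trans_eq ?_
    · rw [Set.uIoc_of_le (hmono (Nat.le_succ j))] at hx
      have h0 : 0 ≤ s j := hs0 ▸ hmono (Nat.zero_le j)
      have h1 : s (j + 1) ≤ t := hsn ▸ hmono hjn
      have hξj := hξ n j (by omega)
      rw [hs] at hξj
      have hξ1 : s j ≤ ξ n j := hξj.1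
      have hξ2 : ξ n j ≤ s (j + 1) := hξj.2
      rw [← mul_sub, norm_mul]
      refine mul_le_mul (hC x ⟨h0.trans hx.1.le, hx.2.trans h1⟩) ?_ (norm_nonneg _) hC0
      rw [← dist_eq_norm]
      refine (hgδ _ ⟨h0.trans hξ1, hξ2.trans h1⟩ _ ⟨h0.trans hx.1.le, hx.2.trans h1⟩ ?_).le
      rw [Real.dist_eq, abs_lt]
      have := hstep j
      constructor <;> linarith [hx.1, hx.2]
    · rw [hstep, abs_of_nonneg (by positivity)]
  rw [dist_eq_norm, hsum]
  simp_rw [hs]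
  rw [← Finset.sum_sub_distrib]
  refine (norm_sum_le_of_le _ hbound).trans_lt ?_
  rw [Finset.sum_const, Finset.card_range, nsmul_eq_mul]
  have : ((n + 1 : ℕ) : ℝ) * (C * (ε / (C * t + 1)) * (t / (n + 1))) =
      ε * (C * t / (C * t + 1)) := by push_cast; field_simp
  rw [this]
  refine mul_lt_of_lt_one_right hε ?_
  rw [div_lt_one (by positivity)]
  linarith

/-- Pathwise convergence of the Riemann sums of a Wiener integral. -/
lemma tendsto_sum_increments {f f' g : ℝ → ℝ} (hf : ∀ s, HasDerivAt f (f' s) s)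
    (hf' : Continuous f') (hg : Continuous g) (hg0 : g 0 = 0) {t : ℝ} (ht : 0 ≤ t) :
    Tendsto (fun n : ℕ => ∑ j ∈ Finset.range (n + 1), f ((j : ℝ) / (n + 1) * t) *
      (g ((j + 1 : ℝ) / (n + 1) * t) - g ((j : ℝ) / (n + 1) * t))) atTop
      (𝓝 (f t * g t - ∫ s in (0 : ℝ)..t, f' s * g s)) := by
  -- Right end points, because summation by parts pairs the increments of `f` with the later value
  -- of `g`.
  have h := tendsto_riemann_sum hf' hg ht (fun n j : ℕ => (j + 1 : ℝ) / (n + 1) * t)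
    (fun (n j : ℕ) _ => ⟨by gcongr; linarith, le_rfl⟩)
  refine (tendsto_const_nhds.sub h).congr fun n => ?_
  have hn0 : (n + 1 : ℝ) ≠ 0 := by positivity
  let s : ℕ → ℝ := fun j => (j : ℝ) / (n + 1) * t
  have hs : ∀ j : ℕ, (j + 1 : ℝ) / (n + 1) * t = s (j + 1) := fun j => by simp [s]
  have hs' : ∀ j : ℕ, (j : ℝ) / (n + 1) * t = s j := fun j => rfl
  simp_rw [hs, hs']
  have hint : ∀ j, ∫ x in (s j)..(s (j + 1)), f' x = f (s (j + 1)) - f (s j) := fun j =>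
    intervalIntegral.integral_eq_sub_of_hasDerivAt (fun x _ => hf x)
      (hf'.intervalIntegrable _ _)
  simp_rw [hint]
  have htel := Finset.sum_range_sub (fun j => f (s j) * g (s j)) (n + 1)
  have hs0 : s 0 = 0 := by simp [s]
  have hsn : s (n + 1) = t := by simp only [s]; push_cast; rw [div_self hn0, one_mul]
  rw [hs0, hsn, hg0, mul_zero, sub_zero] at htel
  rw [← htel, ← Finset.sum_sub_distrib]
  exact Finset.sum_congr rfl fun j _ => by ring

/-- The law of a sum of Wiener integrals of smooth functions with respect to independent Brownian
motions. The integrals are defined by integration by parts. -/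
theorem hasLaw_wienerIntegral {ι : Type*} [Fintype ι] {B : ι → ℝ≥0 → Ω → ℝ}
    (hB : ∀ b, IsBrownianReal (B b) P)
    (hind : iIndepFun (fun b ω t => B b t ω) P) {f f' : ι → ℝ → ℝ}
    (hf : ∀ b s, HasDerivAt (f b) (f' b s) s) (hf' : ∀ b, Continuous (f' b)) (t : ℝ≥0) :
    HasLaw (fun ω => ∑ b, (f b t * B b t ω - ∫ s in (0 : ℝ)..t, f' b s * B b s.toNNReal ω))
      (gaussianReal 0 (∑ b, ∫ s in (0 : ℝ)..t, f b s ^ 2).toNNReal) P := by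
  let s : ℕ → ℕ → ℝ≥0 := fun n j => (j : ℝ≥0) / (n + 1) * t
  have hsr : ∀ n j, (s n j : ℝ) = (j : ℝ) / (n + 1) * t := fun n j => by simp [s]
  have hmono : ∀ n, Monotone (s n) := fun n i j hij => by
    simp only [s]; gcongr
  let R : ℕ → ι → Ω → ℝ := fun n b ω =>
    ∑ j ∈ Finset.range (n + 1), f b (s n j) * (B b (s n (j + 1)) ω - B b (s n j) ω)
  have hcont : ∀ b, Continuous (f b) := fun b =>
    continuous_iff_continuousAt.2 fun x => (hf b x).continuousAt
  refine hasLaw_gaussianReal_of_tendsto (Y := fun n ω => ∑ b, R n b ω)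
    (v := fun n => ∑ b, (∑ j ∈ Finset.range (n + 1),
      f b (s n j) ^ 2 * ((s n (j + 1) : ℝ) - s n j)).toNNReal) (fun n => ?_) ?_ ?_
  · refine hasLaw_gaussianReal_sum (fun b =>
      hasLaw_sum_increments (hB b).toIsPreBrownianReal (hmono n) _ _) ?_
    exact hind.comp (fun b path => ∑ j ∈ Finset.range (n + 1),
      f b (s n j) * (path (s n (j + 1)) - path (s n j))) (fun b => by fun_prop)
  · rw [Real.toNNReal_sum_of_nonneg fun b _ =>
      intervalIntegral.integral_nonneg t.coe_nonneg fun x _ => sq_nonneg _]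
    refine tendsto_finsetSum _ fun b _ => ?_
    refine (continuous_real_toNNReal.tendsto _).comp ?_
    -- With integrand 1 the weights are the interval lengths, so these Riemann sums are the
    -- variances of the step approximations.
    have h := tendsto_riemann_sum (f := fun _ => 1) continuous_const ((hcont b).pow 2)
      t.coe_nonneg (fun n j : ℕ => (j : ℝ) / (n + 1) * t)
      (fun (n j : ℕ) _ => ⟨le_rfl, by gcongr; linarith⟩)
    simp only [one_mul] at h
    refine h.congr fun n => Finset.sum_congr rfl fun j _ => ?_
    simp [hsr, mul_comm]
  · have hc : ∀ᵐ ω ∂P, ∀ b, Continuous (B b · ω) := ae_all_iff.2 fun b => (hB b).cont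
    have h0 : ∀ᵐ ω ∂P, ∀ b, B b 0 ω = 0 := ae_all_iff.2 fun b => (hB b).eval_zero_ae_eq_zero
    filter_upwards [hc, h0] with ω hω hω0
    refine tendsto_finsetSum _ fun b _ => ?_
    have h := tendsto_sum_increments (hf b) (hf' b)
      (g := fun r => B b r.toNNReal ω) ((hω b).comp continuous_real_toNNReal)
      (by simp [hω0 b]) t.coe_nonneg
    simp only [Real.toNNReal_coe] at h
    refine h.congr fun n => Finset.sum_congr rfl fun j _ => ?_
    have e1 : (j + 1 : ℝ) / (n + 1) * t = s n (j + 1) := by rw [hsr]; push_cast; rfl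
    rw [e1, ← hsr, Real.toNNReal_coe, Real.toNNReal_coe]

end Wiener

/-! ### Linear differential equations -/

section LinearFlow

variable {E : Type*} [NormedAddCommGroup E] [NormedSpace ℝ E]

/-- The flow of the linear differential equation `u' = F u`. -/
noncomputable def linearFlow (F : E →L[ℝ] E) (s : ℝ) : E →L[ℝ] E := NormedSpace.exp (s • F)

lemma linearFlow_zero (F : E →L[ℝ] E) (x : E) : linearFlow F 0 x = x := by
  simp [linearFlow]

variable [CompleteSpace E]

lemma hasDerivAt_linearFlow (F : E →L[ℝ] E) (x : E) (s : ℝ) :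
    HasDerivAt (fun r => linearFlow F r x) (F (linearFlow F s x)) s := by
  have h := hasDerivAt_exp_smul_const' (𝕂 := ℝ) F s
  exact (ContinuousLinearMap.apply ℝ E x).hasFDerivAt.comp_hasDerivAt s h

lemma continuous_linearFlow (F : E →L[ℝ] E) (x : E) : Continuous fun r => linearFlow F r x :=
  continuous_iff_continuousAt.2 fun s => (hasDerivAt_linearFlow F x s).continuousAt

/-- Solvability of affine differential equations. -/
lemma exists_hasDerivAt_affine (F : E →L[ℝ] E) (b x : E) :
    ∃ m : ℝ → E, m 0 = x ∧ ∀ s, HasDerivAt m (F (m s) + b) s := by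
  -- An extra coordinate, constantly equal to 1 along the solution, makes the affine equation
  -- linear.
  let G : E × ℝ →L[ℝ] E × ℝ :=
    (F.comp (ContinuousLinearMap.fst ℝ E ℝ) +
      (ContinuousLinearMap.snd ℝ E ℝ).smulRight b).prod 0
  have h := fun s => hasDerivAt_linearFlow G (x, 1) s
  have h2 : ∀ s, (linearFlow G s (x, 1)).2 = 1 := by
    have hd : ∀ s, HasDerivAt (fun r => (linearFlow G r (x, 1)).2) 0 s := fun s =>
      (ContinuousLinearMap.snd ℝ E ℝ).hasFDerivAt.comp_hasDerivAt s (h s)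
    intro s
    rw [is_const_of_deriv_eq_zero (fun r => (hd r).differentiableAt) (fun r => (hd r).deriv) s 0,
      linearFlow_zero]
  refine ⟨fun s => (linearFlow G s (x, 1)).1, by simp only [linearFlow_zero], fun s => ?_⟩
  have h1 := (ContinuousLinearMap.fst ℝ E ℝ).hasFDerivAt.comp_hasDerivAt s (h s)
  refine h1.congr_deriv ?_
  simp [G, h2 s]

end LinearFlow

end GinzburgLandau

namespace GinzburgLandau

/-! ### The law of the diffusion -/

section Diffusion

open Classical

variable {d : ℕ} {Λ Δ : Finset (Site d)}

/-- The extension by zero of a function on `Λ`. -/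
noncomputable def extendZero (v : Λ → ℝ) (x : Site d) : ℝ := if h : x ∈ Λ then v ⟨x, h⟩ else 0

lemma extendZero_coe (v : Λ → ℝ) (x : Λ) : extendZero v x = v x := by simp [extendZero]

lemma extendZero_of_mem (hdisj : Disjoint Λ Δ) (v : Λ → ℝ) (y : Δ) : extendZero v y = 0 := by
  rw [extendZero, dif_neg (Finset.disjoint_right.1 hdisj y.2)]

lemma sum_union_coe {E : Type*} [AddCommMonoid E] (hdisj : Disjoint Λ Δ) (h : Site d → E) :
    ∑ y : ↥(Λ ∪ Δ), h y = ∑ y : Λ, h y + ∑ y : Δ, h y := by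
  rw [Finset.sum_coe_sort (Λ ∪ Δ) h, Finset.sum_union hdisj, Finset.sum_coe_sort Λ h,
    Finset.sum_coe_sort Δ h]

lemma sum_mul_eq_sum_union (hdisj : Disjoint Λ Δ) (v : Λ → ℝ) (h : Site d → ℝ) :
    ∑ x : Λ, v x * h x = ∑ x : ↥(Λ ∪ Δ), extendZero v x * h x := by
  rw [sum_union_coe hdisj fun x => extendZero v x * h x]
  simp [extendZero_coe, extendZero_of_mem hdisj]

variable (Λ Δ) in
/-- The oriented bonds of `Λ ∪ Δ`. -/
abbrev InnerBond : Type :=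
  {p : ↥(Λ ∪ Δ) × ↥(Λ ∪ Δ) // Nbr p.1.1 p.2.1 ∧ LexLt p.1.1 p.2.1}

lemma sum_innerBond {E : Type*} [AddCommMonoid E] (h : ↥(Λ ∪ Δ) → ↥(Λ ∪ Δ) → E) :
    ∑ k : InnerBond Λ Δ, h k.1.1 k.1.2 =
      ∑ x, ∑ y, if Nbr x.1 y.1 ∧ LexLt x.1 y.1 then h x y else 0 := by
  rw [← Finset.sum_subtype (Finset.univ.filter fun p : ↥(Λ ∪ Δ) × ↥(Λ ∪ Δ) =>
    Nbr p.1.1 p.2.1 ∧ LexLt p.1.1 p.2.1) (by simp) fun p => h p.1 p.2, Finset.sum_filter,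
    Fintype.sum_prod_type]

/-- The gradient of a function on `Λ` along the bonds of `Λ ∪ Δ`. -/
noncomputable def bondGradient (k : InnerBond Λ Δ) : (Λ → ℝ) →ₗ[ℝ] ℝ where
  toFun v := extendZero v k.1.1 - extendZero v k.1.2
  map_add' u v := by simp only [extendZero]; split_ifs <;> simp <;> ring
  map_smul' c v := by simp only [extendZero]; split_ifs <;> simp <;> ring

lemma bondGradient_apply (k : InnerBond Λ Δ) (v : Λ → ℝ) :
    bondGradient k v = extendZero v k.1.1 - extendZero v k.1.2 := rfl

variable (Λ Δ) in
/-- The Laplacian on `Λ` with killing at `Δ`. -/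
noncomputable def killedLaplacian : (Λ → ℝ) →L[ℝ] (Λ → ℝ) :=
  LinearMap.toContinuousLinearMap
    { toFun := fun v x => (∑ y : Λ, if Nbr x.1 y.1 then v x - v y else 0) +
        ∑ y : Δ, if Nbr x.1 y.1 then v x else 0
      map_add' := fun u v => by
        ext x
        simp only [Pi.add_apply]
        rw [add_add_add_comm, ← Finset.sum_add_distrib, ← Finset.sum_add_distrib]
        congr 1 <;> refine Finset.sum_congr rfl fun y _ => ?_ <;> split_ifs <;> ring
      map_smul' := fun c v => by
        ext x
        simp only [Pi.smul_apply, smul_eq_mul, RingHom.id_apply, mul_add, Finset.mul_sum]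
        congr 1 <;> refine Finset.sum_congr rfl fun y _ => ?_ <;> split_ifs <;> ring }

lemma killedLaplacian_apply (v : Λ → ℝ) (x : Λ) :
    killedLaplacian Λ Δ v x = (∑ y : Λ, if Nbr x.1 y.1 then v x - v y else 0) +
        ∑ y : Δ, if Nbr x.1 y.1 then v x else 0 := rfl

/-- Summation by parts, `A = ∇ᵀ∇`. Extension by zero turns the killing at `Δ` into ordinary
differences, and bonds inside `Δ` contribute nothing. Symmetry and positivity of `A` follow from
this form. -/
lemma dotProduct_killedLaplacian (hdisj : Disjoint Λ Δ) (u v : Λ → ℝ) :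
    u ⬝ᵥ killedLaplacian Λ Δ v = ∑ k : InnerBond Λ Δ, bondGradient k u * bondGradient k v := by
  have h1 : ∀ x : Λ, killedLaplacian Λ Δ v x = ∑ y : ↥(Λ ∪ Δ),
      if Nbr x.1 y.1 then extendZero v x - extendZero v y else 0 := fun x => by
    rw [sum_union_coe hdisj fun y => if Nbr x.1 y then extendZero v x - extendZero v y else 0]
    simp [extendZero_coe, extendZero_of_mem hdisj, killedLaplacian_apply]
  simp_rw [dotProduct, h1]
  rw [sum_mul_eq_sum_union hdisj u fun x => ∑ y : ↥(Λ ∪ Δ),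
      if Nbr x y.1 then extendZero v x - extendZero v y else 0]
  simp_rw [Finset.mul_sum, mul_ite, mul_zero]
  rw [← sum_lexLt_add_swap (V := ↥(Λ ∪ Δ)) (E := ℝ) (fun x => x.1)
    fun x y => extendZero u x * (extendZero v x - extendZero v y)]
  simp only [bondGradient_apply]
  rw [sum_innerBond fun x y : ↥(Λ ∪ Δ) => (extendZero u x - extendZero u y) *
    (extendZero v x - extendZero v y)]
  refine Finset.sum_congr rfl fun x _ => Finset.sum_congr rfl fun y _ => ?_
  split_ifs <;> ring

lemma dotProduct_killedLaplacian_comm (hdisj : Disjoint Λ Δ) (u v : Λ → ℝ) :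
    u ⬝ᵥ killedLaplacian Λ Δ v = killedLaplacian Λ Δ u ⬝ᵥ v := by
  rw [dotProduct_comm (killedLaplacian Λ Δ u), dotProduct_killedLaplacian hdisj,
    dotProduct_killedLaplacian hdisj]
  exact Finset.sum_congr rfl fun k _ => mul_comm _ _

/-- The currents from the reservoirs. -/
noncomputable def reservoirInput (σ : Δ → ℝ) (x : Λ) : ℝ :=
  ∑ y : Δ, if Nbr x.1 y.1 then σ y else 0

lemma partialDeriv_quadraticH {V : Type*} [Fintype V] [DecidableEq V] (x : V) (φ : V → ℝ) :
    partialDeriv quadraticH x φ = φ x := by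
  have h : (fun u => quadraticH (Function.update φ x u)) =
      fun u => (1 / 2) * (u ^ 2 + ∑ y ∈ Finset.univ \ {x}, φ y ^ 2) := by
    ext u
    have h2 : ∀ y, Function.update φ x u y ^ 2 = Function.update (fun y => φ y ^ 2) x (u ^ 2) y :=
      fun y => by by_cases hy : y = x <;> simp [hy]
    simp only [quadraticH, h2]
    rw [Finset.sum_update_of_mem (Finset.mem_univ x)]
  rw [partialDeriv, h]
  have hd : HasDerivAt (fun u : ℝ => (1 / 2) * (u ^ 2 + ∑ y ∈ Finset.univ \ {x}, φ y ^ 2))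
      ((1 / 2) * (2 * φ x)) (φ x) := by
    simpa using (((hasDerivAt_id (φ x)).pow 2).add_const _).const_mul (1 / 2 : ℝ)
  rw [hd.deriv]
  ring

lemma outflow_quadraticH (σ : Δ → ℝ) (φ : Λ → ℝ) (x : Λ) :
    outflow Λ Δ σ quadraticH φ x = killedLaplacian Λ Δ φ x - reservoirInput σ x := by
  rw [outflow, killedLaplacian_apply, reservoirInput, add_sub_assoc, ← Finset.sum_sub_distrib]
  simp only [partialDeriv_quadraticH]
  congr 1
  refine Finset.sum_congr rfl fun y _ => ?_
  split_ifs <;> ring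

/-! ### The noise as the adjoint of the bond gradient. -/

section Noise

variable {n : ℕ} [NeZero d] {Ω : Type*} (hdom : ∀ x ∈ Λ ∪ Δ, x ∈ domain d n)

/-- The bonds of `Λ ∪ Δ` as bonds of the domain. -/
def InnerBond.toBond (k : InnerBond Λ Δ) : Bond d n :=
  ⟨(k.1.1.1, k.1.2.1), hdom _ k.1.1.2, hdom _ k.1.2.2, k.2.1, k.2.2⟩

lemma InnerBond.toBond_injective : Function.Injective (InnerBond.toBond (Λ := Λ) (Δ := Δ) hdom) := by
  intro k l h
  have h' : (k.1.1.1, k.1.2.1) = (l.1.1.1, l.1.2.1) := congrArg Subtype.val h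
  rw [Prod.mk.injEq] at h'
  exact Subtype.ext (Prod.ext (Subtype.ext h'.1) (Subtype.ext h'.2))

/-- Each Brownian motion enters the two ends of its bond with opposite signs, so the noise is `∇ᵀB`,
with the gradient that also factors the drift. This matching makes the Gaussian product measure
stationary. -/
lemma dotProduct_totalNoise (hdisj : Disjoint Λ Δ) (B : Bond d n → ℝ≥0 → Ω → ℝ) (v : Λ → ℝ)
    (t : ℝ≥0) (ω : Ω) :
    (v ⬝ᵥ fun x => totalNoise Λ Δ B x t ω) =
      ∑ k : InnerBond Λ Δ, bondGradient k v * B (k.toBond hdom) t ω := by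
  have h1 : ∀ x : Λ, totalNoise Λ Δ B x t ω = ∑ y : ↥(Λ ∪ Δ),
      if Nbr x.1 y.1 then bondNoise B x y t ω else 0 := fun x => by
    rw [sum_union_coe hdisj fun y => if Nbr x.1 y then bondNoise B x y t ω else 0, totalNoise]
  simp_rw [dotProduct, h1]
  rw [sum_mul_eq_sum_union hdisj v fun x => ∑ y : ↥(Λ ∪ Δ),
      if Nbr x y.1 then bondNoise B x y t ω else 0]
  simp_rw [Finset.mul_sum, mul_ite, mul_zero]
  rw [← sum_lexLt_add_swap (V := ↥(Λ ∪ Δ)) (E := ℝ) (fun x => x.1)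
    fun x y => extendZero v x * bondNoise B x y t ω, ← sum_innerBond]
  refine Finset.sum_congr rfl fun k _ => ?_
  have e1 : bondNoise B k.1.1.1 k.1.2.1 t ω = B (k.toBond hdom) t ω := by
    rw [bondNoise, dif_pos ⟨hdom _ k.1.1.2, hdom _ k.1.2.2, k.2.1, k.2.2⟩]
    rfl
  have e2 : bondNoise B k.1.2.1 k.1.1.1 t ω = -B (k.toBond hdom) t ω := by
    rw [bondNoise, dif_neg fun h => k.2.2.asymm h.2.2.2,
      dif_pos ⟨hdom _ k.1.1.2, hdom _ k.1.2.2, k.2.1, k.2.2⟩]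
    rfl
  rw [e1, e2, bondGradient_apply]
  ring

end Noise

end Diffusion

/-! ### Linear stochastic equations, pathwise -/

section Pathwise

variable {V : Type*} [Fintype V]

lemma hasDerivAt_dotProduct {u v : ℝ → V → ℝ} {u' v' : V → ℝ} {s : ℝ} (hu : HasDerivAt u u' s)
    (hv : HasDerivAt v v' s) :
    HasDerivAt (fun r => u r ⬝ᵥ v r) (u' ⬝ᵥ v s + u s ⬝ᵥ v') s := by
  simp only [dotProduct, ← Finset.sum_add_distrib]
  exact HasDerivAt.fun_sum fun x _ => (hasDerivAt_pi.1 hu x).fun_mul (hasDerivAt_pi.1 hv x)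

lemma hasDerivAt_linearFlow_sub (A : (V → ℝ) →L[ℝ] (V → ℝ)) (θ : V → ℝ) (t s : ℝ) :
    HasDerivAt (fun r => linearFlow (-A) (t - r) θ) (A (linearFlow (-A) (t - s) θ)) s := by
  simpa using! (hasDerivAt_linearFlow (-A) θ (t - s)).comp_const_sub t s

variable {A : (V → ℝ) →L[ℝ] (V → ℝ)} (hA : ∀ u v, u ⬝ᵥ A v = A u ⬝ᵥ v)
include hA

/-- Running one vector backward and the other forward keeps the pairing constant, by symmetry of
`A`; the end times give the two sides. -/
lemma dotProduct_linearFlow_comm (u v : V → ℝ) (t : ℝ) :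
    u ⬝ᵥ linearFlow (-A) t v = linearFlow (-A) t u ⬝ᵥ v := by
  have hd : ∀ s, HasDerivAt (fun r => linearFlow (-A) (t - r) u ⬝ᵥ linearFlow (-A) r v) 0 s := by
    intro s
    refine (hasDerivAt_dotProduct (hasDerivAt_linearFlow_sub A u t s)
      (hasDerivAt_linearFlow (-A) v s)).congr_deriv ?_
    rw [neg_apply, dotProduct_neg, hA, add_neg_cancel]
  have h := is_const_of_deriv_eq_zero (fun s => (hd s).differentiableAt) (fun s => (hd s).deriv) t 0
  simpa [linearFlow_zero] using h

/-- Variation of constants for a linear equation with additive noise, tested against `θ`. -/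
lemma dotProduct_eq_of_integral_equation {Y W : ℝ → V → ℝ} (hY : Continuous Y) (hW : Continuous W)
    (c : ℝ) (hEq : ∀ t, 0 ≤ t → ∀ x, Y t x = -∫ s in (0 : ℝ)..t, A (Y s + c • W s) x)
    (θ : V → ℝ) {t : ℝ} (ht : 0 ≤ t) :
    θ ⬝ᵥ Y t = -(c * ∫ s in (0 : ℝ)..t, A (linearFlow (-A) (t - s) θ) ⬝ᵥ W s) := by
  -- The equation determines `Y` only at nonnegative times; `Z` agrees with it there and is
  -- differentiable on the whole line. Paired with the reversed flow, its linear drift cancels and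
  -- only the noise term survives.
  let Z : ℝ → V → ℝ := fun t x => -∫ s in (0 : ℝ)..t, A (Y s + c • W s) x
  have hYZ : ∀ t, 0 ≤ t → Y t = Z t := fun t ht => funext fun x => hEq t ht x
  have hcont : Continuous fun s => A (Y s + c • W s) := by fun_prop
  have hZ : ∀ s, HasDerivAt Z (-A (Y s + c • W s)) s := fun s => hasDerivAt_pi.2 fun x =>
    (((continuous_apply x).comp hcont).integral_hasStrictDerivAt 0 s).hasDerivAt.neg
  have hflow : Continuous fun s => linearFlow (-A) (t - s) θ :=
    (continuous_linearFlow (-A) θ).comp (continuous_const.sub continuous_id)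
  have hd : ∀ s ∈ Set.uIcc 0 t,
      HasDerivAt (fun r => linearFlow (-A) (t - r) θ ⬝ᵥ Z r)
        (-c * (A (linearFlow (-A) (t - s) θ) ⬝ᵥ W s)) s := by
    intro s hs
    rw [Set.uIcc_of_le ht] at hs
    refine (hasDerivAt_dotProduct (hasDerivAt_linearFlow_sub A θ t s) (hZ s)).congr_deriv ?_
    rw [← hYZ s hs.1, dotProduct_neg, hA, dotProduct_add, dotProduct_smul, smul_eq_mul]
    ring
  have hdot : Continuous fun s => A (linearFlow (-A) (t - s) θ) ⬝ᵥ W s := by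
    simp only [dotProduct]
    fun_prop
  have h := intervalIntegral.integral_eq_sub_of_hasDerivAt hd
    ((continuous_const.mul hdot).intervalIntegrable _ _)
  rw [intervalIntegral.integral_const_mul] at h
  have hZ0 : Z 0 = 0 := by ext x; simp [Z]
  simp only [sub_self, linearFlow_zero, hZ0, dotProduct_zero, sub_zero] at h
  rw [hYZ t ht, ← h]
  ring

/-- The energy identity for the linear flow. -/
lemma integral_dotProduct_linearFlow (θ : V → ℝ) (t : ℝ) :
    ∫ s in (0 : ℝ)..t, linearFlow (-A) (t - s) θ ⬝ᵥ A (linearFlow (-A) (t - s) θ) =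
      (θ ⬝ᵥ θ - linearFlow (-A) t θ ⬝ᵥ linearFlow (-A) t θ) / 2 := by
  have hd : ∀ s ∈ Set.uIcc 0 t,
      HasDerivAt (fun r => (linearFlow (-A) (t - r) θ ⬝ᵥ linearFlow (-A) (t - r) θ) / 2)
        (linearFlow (-A) (t - s) θ ⬝ᵥ A (linearFlow (-A) (t - s) θ)) s := by
    intro s _
    refine ((hasDerivAt_dotProduct (hasDerivAt_linearFlow_sub A θ t s)
      (hasDerivAt_linearFlow_sub A θ t s)).div_const 2).congr_deriv ?_
    rw [← hA]
    ring
  have hflow : Continuous fun s => linearFlow (-A) (t - s) θ :=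
    (continuous_linearFlow (-A) θ).comp (continuous_const.sub continuous_id)
  have hdot : Continuous fun s =>
      linearFlow (-A) (t - s) θ ⬝ᵥ A (linearFlow (-A) (t - s) θ) := by
    simp only [dotProduct]
    fun_prop
  rw [intervalIntegral.integral_eq_sub_of_hasDerivAt hd (hdot.intervalIntegrable _ _)]
  simp only [sub_self, linearFlow_zero, sub_zero]
  ring

end Pathwise

end GinzburgLandau

namespace GinzburgLandau

/-! ### Gaussian vectors in `ℝ^V` -/

section GaussianVector

variable {V : Type*} [Fintype V]

lemma exists_dotProduct_eq (L : StrongDual ℝ (V → ℝ)) : ∃ θ : V → ℝ, ∀ z, L z = θ ⬝ᵥ z := by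
  classical
  refine ⟨fun x => L (Pi.single x 1), fun z => ?_⟩
  conv_lhs => rw [← Finset.univ_sum_single z, map_sum]
  refine Finset.sum_congr rfl fun x _ => ?_
  have : (Pi.single x (z x) : V → ℝ) = z x • Pi.single x 1 := by
    rw [← Pi.single_smul, smul_eq_mul, mul_one]
  rw [this, map_smul, smul_eq_mul, mul_comm]

lemma charFunDual_eq_of_hasLaw {μ : Measure (V → ℝ)} [IsProbabilityMeasure μ]
    {L : StrongDual ℝ (V → ℝ)} {w : ℝ≥0} (h : HasLaw L (gaussianReal 0 w) μ) :
    charFunDual μ L = Complex.exp (-w / 2) := by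
  rw [charFunDual_eq_charFun_map_one, h.map_eq, charFun_gaussianReal]
  simp [neg_div]

variable {μ : Measure (V → ℝ)} {q : (V → ℝ) → ℝ≥0}
  (hμ : ∀ θ : V → ℝ, HasLaw (fun z => θ ⬝ᵥ z) (gaussianReal 0 (q θ)) μ)
include hμ

lemma isGaussian_of_hasLaw_dotProduct : IsGaussian μ :=
  isGaussian_of_map_eq_gaussianReal fun L => by
    obtain ⟨θ, hθ⟩ := exists_dotProduct_eq L
    exact ⟨0, q θ, by rw [show (L : (V → ℝ) → ℝ) = fun z => θ ⬝ᵥ z from funext hθ, (hμ θ).map_eq]⟩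

lemma integral_id_eq_zero_of_hasLaw_dotProduct : μ[id] = 0 := by
  have := isGaussian_of_hasLaw_dotProduct hμ
  have h : ∀ L : StrongDual ℝ (V → ℝ), L (∫ z, z ∂μ) = 0 := fun L => by
    obtain ⟨θ, hθ⟩ := exists_dotProduct_eq L
    rw [← IsGaussian.integral_dual, show (fun z => L z) = fun z => θ ⬝ᵥ z from funext hθ,
      (hμ θ).integral_eq, integral_id_gaussianReal]
  ext x
  exact h (ContinuousLinearMap.proj x)

omit hμ in
lemma hasLaw_dotProduct_pi (v : ℝ≥0) (θ : V → ℝ) :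
    HasLaw (fun z : V → ℝ => θ ⬝ᵥ z) (gaussianReal 0 ((θ ⬝ᵥ θ).toNNReal * v))
      (Measure.pi fun _ : V => gaussianReal 0 v) := by
  have hind := iIndepFun_pi (μ := fun _ : V => gaussianReal 0 v) (X := fun x r => θ x * r)
    (fun x => by fun_prop)
  have heval : ∀ x, HasLaw (fun z : V → ℝ => z x) (gaussianReal 0 v)
      (Measure.pi fun _ : V => gaussianReal 0 v) := fun x =>
    (measurePreserving_eval (fun _ : V => gaussianReal 0 v) x).hasLaw
  have h := hasLaw_gaussianReal_sum (fun x => hasLaw_gaussianReal_const_mul (heval x) (θ x)) hind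
  rw [← Finset.sum_mul, ← Real.toNNReal_sum_of_nonneg fun x _ => sq_nonneg (θ x)] at h
  simpa only [dotProduct, pow_two] using h

/-- Stationarity of the Gaussian product measure, stated through variances. -/
lemma map_add_linear_eq_pi [IsProbabilityMeasure μ] {v : ℝ≥0} (E : (V → ℝ) →L[ℝ] (V → ℝ))
    (hE : ∀ u w, u ⬝ᵥ E w = E u ⬝ᵥ w)
    (hq : ∀ θ, q θ + (E θ ⬝ᵥ E θ).toNNReal * v = (θ ⬝ᵥ θ).toNNReal * v) :
    (μ.prod (Measure.pi fun _ : V => gaussianReal 0 v)).map (fun p => p.1 + E p.2) =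
      Measure.pi fun _ : V => gaussianReal 0 v := by
  set γ := Measure.pi fun _ : V => gaussianReal 0 v
  let T : (V → ℝ) × (V → ℝ) →L[ℝ] (V → ℝ) :=
    ContinuousLinearMap.fst ℝ _ _ + E.comp (ContinuousLinearMap.snd ℝ _ _)
  have hT : (fun p : (V → ℝ) × (V → ℝ) => p.1 + E p.2) = T := by ext p; simp [T]
  have hTm : Measurable T := T.continuous.measurable
  rw [hT]
  have : IsProbabilityMeasure ((μ.prod γ).map T) :=
    Measure.isProbabilityMeasure_map hTm.aemeasurable
  refine Measure.ext_of_charFunDual (funext fun L => ?_)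
  obtain ⟨θ, hθ⟩ := exists_dotProduct_eq L
  have hL : (L : (V → ℝ) → ℝ) = fun z => θ ⬝ᵥ z := funext hθ
  have h1 : charFunDual μ L = Complex.exp (-(q θ : ℝ) / 2) :=
    charFunDual_eq_of_hasLaw (by rw [hL]; exact hμ θ)
  have h2 : charFunDual γ (L.comp E) =
      Complex.exp (-(((E θ ⬝ᵥ E θ).toNNReal * v : ℝ≥0) : ℝ) / 2) := by
    refine charFunDual_eq_of_hasLaw ?_
    have : (L.comp E : (V → ℝ) → ℝ) = fun z => E θ ⬝ᵥ z := funext fun z => by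
      rw [ContinuousLinearMap.comp_apply, hθ, hE]
    rw [this]
    exact hasLaw_dotProduct_pi v (E θ)
  have h3 : charFunDual γ L = Complex.exp (-(((θ ⬝ᵥ θ).toNNReal * v : ℝ≥0) : ℝ) / 2) :=
    charFunDual_eq_of_hasLaw (by rw [hL]; exact hasLaw_dotProduct_pi v θ)
  have e1 : (L.comp T).comp (ContinuousLinearMap.inl ℝ _ _) = L := by ext z; simp [T]
  have e2 : (L.comp T).comp (ContinuousLinearMap.inr ℝ _ _) = L.comp E := by ext z; simp [T]
  rw [charFunDual_map, charFunDual_prod, e1, e2, h1, h2, h3, ← Complex.exp_add, ← hq θ]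
  congr 1
  push_cast
  ring

omit hμ in
/-- A Gaussian perturbation of a holomorphic monomial that is averaged over an imaginary Gaussian
vector acts on the imaginary part only. -/
theorem integral_integral_monomialFn (ν γ : Measure (V → ℝ)) [IsGaussian ν] [IsGaussian γ]
    (hν : ν[id] = 0) (E : (V → ℝ) →L[ℝ] (V → ℝ))
    (hE : (ν.prod γ).map (fun p => p.1 + E p.2) = γ) (k : V → ℕ) (a : V → ℝ) :
    ∫ z, ∫ g, monomialFn k (toComplexPi (a + z) + Complex.I • toComplexPi g) ∂γ ∂ν =
      ∫ g, monomialFn k (toComplexPi a + Complex.I • toComplexPi (E g)) ∂γ := by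
  let F : ((V → ℝ) × (V → ℝ)) × (V → ℝ) → ℂ := fun p =>
    monomialFn k ((toComplexPi a + Complex.I • toComplexPi (E p.2)) +
      (toComplexPi p.1.1 + Complex.I • toComplexPi p.1.2))
  have hF : Integrable F ((ν.prod ν).prod γ) := by
    refine integrable_monomialFn k fun p => ?_
    have h1 : MemLp (fun z => toComplexPi (E z)) p γ :=
      ((toComplexPi.comp E).comp_memLp' (IsGaussian.memLp_id γ p (by simp)) :)
    have h2 : MemLp (fun z : (V → ℝ) × (V → ℝ) => toComplexPi z.1 + Complex.I • toComplexPi z.2) p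
        (ν.prod ν) :=
      ((memLp_toComplexPi ν p).comp_fst ν).add
        (((memLp_toComplexPi ν p).comp_snd ν).const_smul Complex.I)
    have h3 : MemLp (fun p : ((V → ℝ) × (V → ℝ)) × (V → ℝ) =>
        toComplexPi a + Complex.I • toComplexPi (E p.2)) p ((ν.prod ν).prod γ) :=
      (memLp_const (toComplexPi a)).add ((h1.comp_snd (ν.prod ν)).const_smul Complex.I)
    exact h3.add (h2.comp_fst γ)
  have hassoc := measurePreserving_prodAssoc ν ν γ
  have hF' : Integrable (fun p : (V → ℝ) × (V → ℝ) × (V → ℝ) => F ((p.1, p.2.1), p.2.2))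
      (ν.prod (ν.prod γ)) := by
    rw [← hassoc.map_eq, integrable_map_equiv]
    exact hF
  calc ∫ z, ∫ g, monomialFn k (toComplexPi (a + z) + Complex.I • toComplexPi g) ∂γ ∂ν
      = ∫ z, ∫ p, F ((z, p.1), p.2) ∂(ν.prod γ) ∂ν := by
        congr 1
        ext z
        -- The imaginary Gaussian vector is split into an independent copy of the real perturbation
        -- and its image under `E`.
        conv_lhs => rw [← hE]
        rw [integral_map (by fun_prop)]
        · congr 1
          ext p
          simp only [F, map_add, smul_add]
          congr 1
          abel
        · exact ((continuous_monomialFn k).comp (by fun_prop)).aestronglyMeasurable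
    _ = ∫ p, F ((p.1, p.2.1), p.2.2) ∂(ν.prod (ν.prod γ)) := (integral_prod _ hF').symm
    _ = ∫ p, F p ∂((ν.prod ν).prod γ) := by
        rw [← hassoc.map_eq, integral_map_equiv]
        rfl
    _ = ∫ g, ∫ p, F (p, g) ∂(ν.prod ν) ∂γ := integral_prod_symm _ hF
    _ = ∫ g, monomialFn k (toComplexPi a + Complex.I • toComplexPi (E g)) ∂γ := by
        congr 1
        ext g
        -- With the last Gaussian vector frozen, the remaining pair enters only as `Z + i Z'` and
        -- drops out.
        exact integral_monomialFn_add_I_smul ν hν k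
          (toComplexPi a + Complex.I • toComplexPi (E g))

end GaussianVector

/-! ### The law of the solution -/

section Solution

open Classical

variable {d n : ℕ} [NeZero d] {Λ Δ : Finset (Site d)} {Ω : Type*} [MeasurableSpace Ω]
  {P : Measure Ω} [IsProbabilityMeasure P] {β : ℝ} {σ : Δ → ℝ} {B : Bond d n → ℝ≥0 → Ω → ℝ}
  {φ : Λ → ℝ} {Φ : ℝ≥0 → Ω → Λ → ℝ}

/-- The solution is a Gaussian process around the solution `m` of the noiseless equation. -/
theorem hasLaw_dotProduct_solution (hdisj : Disjoint Λ Δ) (hdom : ∀ x ∈ Λ ∪ Δ, x ∈ domain d n)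
    (hβ : 0 < β) (hB : IsBondNoise P B) (hΦ : IsSolution P β Λ Δ σ quadraticH B φ Φ)
    {m : ℝ → Λ → ℝ} (hm0 : m 0 = φ)
    (hm : ∀ s, HasDerivAt m (-killedLaplacian Λ Δ (m s) + reservoirInput σ) s) (t : ℝ≥0)
    (θ : Λ → ℝ) :
    HasLaw (fun ω => θ ⬝ᵥ (Φ t ω - m t)) (gaussianReal 0
      ((θ ⬝ᵥ θ - linearFlow (-killedLaplacian Λ Δ) t θ ⬝ᵥ
        linearFlow (-killedLaplacian Λ Δ) t θ) / β).toNNReal) P := by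
  set A := killedLaplacian Λ Δ with hAdef
  have hA : ∀ u v, u ⬝ᵥ A v = A u ⬝ᵥ v := dotProduct_killedLaplacian_comm hdisj
  have hflow : Continuous fun s => linearFlow (-A) (t - s) θ :=
    (continuous_linearFlow (-A) θ).comp (continuous_const.sub continuous_id)
  have hgrad : ∀ k : InnerBond Λ Δ, Continuous (bondGradient k) := fun k =>
    (bondGradient k).continuous_of_finiteDimensional
  let f : InnerBond Λ Δ → ℝ → ℝ := fun k s => bondGradient k (linearFlow (-A) (t - s) θ)
  let f' : InnerBond Λ Δ → ℝ → ℝ := fun k s => bondGradient k (A (linearFlow (-A) (t - s) θ))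
  have hf : ∀ k s, HasDerivAt (f k) (f' k s) s := fun k s =>
    (bondGradient k).toContinuousLinearMap.hasFDerivAt.comp_hasDerivAt s
      (hasDerivAt_linearFlow_sub A θ t s)
  have hf' : ∀ k, Continuous (f' k) := fun k => (hgrad k).comp (A.continuous.comp hflow)
  have hfc : ∀ k, Continuous (f k) := fun k => (hgrad k).comp hflow
  have hlaw := hasLaw_gaussianReal_const_mul (hasLaw_wienerIntegral
    (fun k : InnerBond Λ Δ => hB.brownian (k.toBond hdom))
    (hB.indep.precomp (InnerBond.toBond_injective hdom)) hf hf' t) (√(2 / β))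
  -- Over the bonds the squared integrands add up to the Dirichlet form of the flow, whose time
  -- integral is half the loss of squared norm; this half cancels the 2 in `2 / β`.
  have hvar : ((√(2 / β)) ^ 2).toNNReal *
      (∑ k, ∫ s in (0 : ℝ)..t, f k s ^ 2).toNNReal =
      ((θ ⬝ᵥ θ - linearFlow (-A) t θ ⬝ᵥ linearFlow (-A) t θ) / β).toNNReal := by
    have h1 : ∑ k, ∫ s in (0 : ℝ)..t, f k s ^ 2 =
        (θ ⬝ᵥ θ - linearFlow (-A) t θ ⬝ᵥ linearFlow (-A) t θ) / 2 := by
      rw [← integral_dotProduct_linearFlow hA, ← intervalIntegral.integral_finsetSum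
        (f := fun k s => f k s ^ 2) fun k _ => ((hfc k).pow 2).intervalIntegrable _ _]
      congr 1
      ext s
      rw [hAdef, dotProduct_killedLaplacian hdisj]
      exact Finset.sum_congr rfl fun k _ => pow_two _
    rw [← Real.toNNReal_mul (sq_nonneg _), h1, Real.sq_sqrt (by positivity)]
    congr 1
    field_simp
  rw [hvar] at hlaw
  refine hlaw.congr ?_
  have hcB : ∀ᵐ ω ∂P, ∀ k : InnerBond Λ Δ, Continuous (B (k.toBond hdom) · ω) :=
    ae_all_iff.2 fun k => (hB.brownian _).cont
  filter_upwards [hΦ.continuous, hΦ.equation, hcB] with ω hc heq hcB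
  let W : ℝ → Λ → ℝ := fun s x => totalNoise Λ Δ B x s.toNNReal ω
  have hWdot : ∀ (v : Λ → ℝ) (s : ℝ), v ⬝ᵥ W s =
      ∑ k : InnerBond Λ Δ, bondGradient k v * B (k.toBond hdom) s.toNNReal ω := fun v s =>
    dotProduct_totalNoise hdom hdisj B v s.toNNReal ω
  have hcB' : ∀ k : InnerBond Λ Δ, Continuous fun s : ℝ => B (k.toBond hdom) s.toNNReal ω :=
    fun k => (hcB k).comp continuous_real_toNNReal
  have hW : Continuous W := continuous_pi fun x => by
    have : (fun s => W s x) = fun s => ∑ k : InnerBond Λ Δ,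
        bondGradient k (Pi.single x 1) * B (k.toBond hdom) s.toNNReal ω := by
      ext s
      rw [← hWdot, single_dotProduct, one_mul]
    rw [this]
    fun_prop
  have hmc : Continuous m := continuous_iff_continuousAt.2 fun s => (hm s).continuousAt
  have hΦc : Continuous fun s : ℝ => Φ s.toNNReal ω := hc.comp continuous_real_toNNReal
  -- Subtracting the noise leaves a path that solves an ordinary integral equation, so no stochastic
  -- integral is needed.
  let Y : ℝ → Λ → ℝ := fun s => Φ s.toNNReal ω - √(2 / β) • W s - m s
  have hY : Continuous Y := ((hΦc.sub (hW.const_smul (√(2 / β)))).sub hmc :)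
  have hEq : ∀ r, 0 ≤ r → ∀ x, Y r x = -∫ s in (0 : ℝ)..r, A (Y s + √(2 / β) • W s) x := by
    intro r hr x
    have h1 := heq r.toNNReal x
    rw [Real.coe_toNNReal _ hr] at h1
    simp_rw [outflow_quadraticH] at h1
    have hAΦ : Continuous fun s : ℝ => A (Φ s.toNNReal ω) x :=
      (continuous_apply x).comp (A.continuous.comp hΦc)
    have hAm : Continuous fun s : ℝ => A (m s) x :=
      (continuous_apply x).comp (A.continuous.comp hmc)
    have h2 : ∫ s in (0 : ℝ)..r, (-A (m s) x + reservoirInput σ x) = m r x - φ x := by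
      rw [← hm0]
      refine intervalIntegral.integral_eq_sub_of_hasDerivAt (f := fun s => m s x)
        (fun s _ => hasDerivAt_pi.1 (hm s) x) ?_
      exact (hAm.neg.add continuous_const).intervalIntegrable _ _
    have h3 : ∀ s, A (Y s + √(2 / β) • W s) x = (A (Φ s.toNNReal ω) x - reservoirInput σ x) +
        (-A (m s) x + reservoirInput σ x) := by
      intro s
      have : Y s + √(2 / β) • W s = Φ s.toNNReal ω - m s := by simp only [Y]; abel
      rw [this, map_sub, Pi.sub_apply]
      ring
    simp_rw [h3]
    rw [intervalIntegral.integral_add (f := fun s : ℝ => A (Φ s.toNNReal ω) x - reservoirInput σ x)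
      (g := fun s => -A (m s) x + reservoirInput σ x)
      ((hAΦ.sub continuous_const).intervalIntegrable _ _)
      ((hAm.neg.add continuous_const).intervalIntegrable _ _), h2]
    simp only [Y, Pi.sub_apply, Pi.smul_apply, smul_eq_mul, W]
    rw [h1]
    ring
  have hmain := dotProduct_eq_of_integral_equation hA hY hW _ hEq θ t.coe_nonneg
  simp only [Y, Real.toNNReal_coe] at hmain
  -- The subtracted noise is the boundary term of the Wiener integrals: at time `t` the reversed
  -- flow is the identity, so `f k t` is the gradient of `θ`.
  have hdecomp : Φ t ω - m t = (Φ t ω - √(2 / β) • W t - m t) + √(2 / β) • W t := by abel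
  rw [hdecomp, dotProduct_add, hmain, dotProduct_smul, hWdot]
  simp_rw [hWdot]
  rw [intervalIntegral.integral_finsetSum (f := fun k s =>
    f' k s * B (InnerBond.toBond hdom k) s.toNNReal ω) fun k _ => ((hf' k).mul (hcB' k)).intervalIntegrable _ _, Finset.sum_sub_distrib]
  simp only [f, f', sub_self, linearFlow_zero, Real.toNNReal_coe, smul_eq_mul]
  ring

end Solution

end GinzburgLandau

namespace GinzburgLandau

/-! ### Duality -/

section Duality

open Classical

variable {d : ℕ} {Λ Δ : Finset (Site d)} {β : ℝ} {σ : Δ → ℝ}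

lemma monomialFn_sumElim {V W : Type*} [Fintype V] [Fintype W] (η : V ⊕ W → ℕ) (z : V → ℂ)
    (w : W → ℂ) :
    monomialFn η (Sum.elim z w) =
      (∏ y, w y ^ η (.inr y)) * monomialFn (fun x => η (.inl x)) z := by
  simp [monomialFn, Fintype.prod_sum_type, mul_comm]

/-- The duality function is a Gaussian average of complex monomials. -/
lemma dualityFn_eq_integral (hβ : 0 < β) (φ : Λ → ℝ) (η : DualConfig Λ Δ) :
    (dualityFn β Λ Δ σ φ η : ℂ) =
      ∫ g, monomialFn η (Sum.elim (toComplexPi φ + Complex.I • toComplexPi g) fun w => (σ w : ℂ))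
        ∂(Measure.pi fun _ : Λ => gaussianReal 0 (β⁻¹).toNNReal) := by
  simp_rw [monomialFn_sumElim]
  rw [integral_const_mul, ← prod_hermiteFn_eq_integral hβ, dualityFn]
  push_cast
  rfl

/-- The complex solutions of the noiseless equation. -/
lemma hasDerivAt_complex_solution {m : ℝ → Λ → ℝ}
    (hm : ∀ s, HasDerivAt m (-killedLaplacian Λ Δ (m s) + reservoirInput σ) s) (g : Λ → ℝ)
    (s : ℝ) (x : Λ) :
    HasDerivAt (fun r => (toComplexPi (m r) +
        Complex.I • toComplexPi (linearFlow (-killedLaplacian Λ Δ) r g)) x)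
      ((∑ w : Λ, if Nbr x.1 w.1 then (toComplexPi (m s) +
        Complex.I • toComplexPi (linearFlow (-killedLaplacian Λ Δ) s g)) w -
          (toComplexPi (m s) +
            Complex.I • toComplexPi (linearFlow (-killedLaplacian Λ Δ) s g)) x else 0) +
        ∑ w : Δ, if Nbr x.1 w.1 then (σ w : ℂ) - (toComplexPi (m s) +
          Complex.I • toComplexPi (linearFlow (-killedLaplacian Λ Δ) s g)) x else 0) s := by
  have h1 := (hasDerivAt_pi.1 (hm s) x).ofReal_comp
  have h2 := (hasDerivAt_pi.1 (hasDerivAt_linearFlow (-killedLaplacian Λ Δ) g s) x).ofReal_comp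
  refine (h1.fun_add (h2.const_mul Complex.I)).congr_deriv ?_
  simp only [Pi.add_apply, Pi.neg_apply, neg_apply, killedLaplacian_apply, reservoirInput,
    Pi.smul_apply, toComplexPi_apply, smul_eq_mul, Complex.ofReal_add, Complex.ofReal_neg,
    Complex.ofReal_sum, apply_ite Complex.ofReal, Complex.ofReal_sub, Complex.ofReal_zero]
  have e1 : ∀ a b : Λ → ℂ, (∑ w : Λ, if Nbr x.1 w.1 then
      a w + Complex.I * b w - (a x + Complex.I * b x) else 0) =
      -(∑ w : Λ, if Nbr x.1 w.1 then a x - a w else 0) -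
        Complex.I * ∑ w : Λ, if Nbr x.1 w.1 then b x - b w else 0 := by
    intro a b
    rw [Finset.mul_sum, ← Finset.sum_neg_distrib, ← Finset.sum_sub_distrib]
    refine Finset.sum_congr rfl fun w _ => ?_
    split_ifs <;> ring
  have e2 : ∀ a b : ℂ, (∑ w : Δ, if Nbr x.1 w.1 then (σ w : ℂ) - (a + Complex.I * b) else 0) =
      (∑ w : Δ, if Nbr x.1 w.1 then (σ w : ℂ) else 0) - (∑ w : Δ, if Nbr x.1 w.1 then a else 0) -
        Complex.I * ∑ w : Δ, if Nbr x.1 w.1 then b else 0 := by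
    intro a b
    rw [Finset.mul_sum, ← Finset.sum_sub_distrib, ← Finset.sum_sub_distrib]
    refine Finset.sum_congr rfl fun w _ => ?_
    split_ifs <;> ring
  rw [e1 (fun w => (m s w : ℂ)) fun w => (linearFlow (-killedLaplacian Λ Δ) s g w : ℂ), e2]
  ring

lemma memLp_toComplexPi_add_I_smul {V : Type*} [Fintype V] (ν γ : Measure (V → ℝ)) [IsGaussian ν]
    [IsGaussian γ] (a : V → ℝ) (p : ℕ) :
    MemLp (fun z : (V → ℝ) × (V → ℝ) => toComplexPi (a + z.1) + Complex.I • toComplexPi z.2) p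
      (ν.prod γ) := by
  have h0 : MemLp (fun _ : (V → ℝ) × (V → ℝ) => toComplexPi a) p (ν.prod γ) := memLp_const _
  have h1 : MemLp (fun z : (V → ℝ) × (V → ℝ) => toComplexPi z.1) p (ν.prod γ) :=
    (memLp_toComplexPi ν p).comp_fst γ
  have h2 : MemLp (fun z : (V → ℝ) × (V → ℝ) => Complex.I • toComplexPi z.2) p (ν.prod γ) :=
    ((memLp_toComplexPi γ p).comp_snd ν).const_smul Complex.I
  simp_rw [map_add]
  exact (h0.add h1).add h2

/-- Duality between the diffusion and the independent random walks, in a general finite volume. -/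
theorem duality [NeZero d] {n : ℕ} (hdisj : Disjoint Λ Δ) (hdom : ∀ x ∈ Λ ∪ Δ, x ∈ domain d n) (hβ : 0 < β)
    {Ω : Type*} [MeasurableSpace Ω] {P : Measure Ω} [IsProbabilityMeasure P]
    {B : Bond d n → ℝ≥0 → Ω → ℝ} (hB : IsBondNoise P B)
    {φ : Λ → ℝ} {Φ : ℝ≥0 → Ω → Λ → ℝ} (hΦ : IsSolution P β Λ Δ σ quadraticH B φ Φ)
    {Ω' : Type*} [MeasurableSpace Ω'] {Q : Measure Ω'} [IsProbabilityMeasure Q]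
    {η : DualConfig Λ Δ} {X : ℝ≥0 → Ω' → DualConfig Λ Δ}
    (hX : IsMarkovJumpProcess Q (dualGenerator Λ Δ) η X) (t : ℝ≥0) :
    Integrable (fun ω => dualityFn β Λ Δ σ (Φ t ω) η) P ∧
      ∫ ω, dualityFn β Λ Δ σ (Φ t ω) η ∂P = ∫ ω, dualityFn β Λ Δ σ φ (X t ω) ∂Q := by
  obtain ⟨m, hm0, hm'⟩ := exists_hasDerivAt_affine (-killedLaplacian Λ Δ)
    (reservoirInput σ) φ
  have hm : ∀ s, HasDerivAt m (-killedLaplacian Λ Δ (m s) + reservoirInput σ) s := hm'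
  set E := linearFlow (-killedLaplacian Λ Δ) t with hEdef
  set γ := Measure.pi fun _ : Λ => gaussianReal 0 (β⁻¹).toNNReal with hγ
  have hEsymm : ∀ u w, u ⬝ᵥ E w = E u ⬝ᵥ w := fun u w =>
    dotProduct_linearFlow_comm (dotProduct_killedLaplacian_comm hdisj) u w t
  let q : (Λ → ℝ) → ℝ≥0 := fun θ => ((θ ⬝ᵥ θ - E θ ⬝ᵥ E θ) / β).toNNReal
  have hZm : AEMeasurable (fun ω => Φ t ω - m t) P := (hΦ.aemeasurable t).sub_const _
  set ν := P.map fun ω => Φ t ω - m t with hν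
  have : IsProbabilityMeasure ν := Measure.isProbabilityMeasure_map hZm
  have hlaw : ∀ θ : Λ → ℝ, HasLaw (fun z => θ ⬝ᵥ z) (gaussianReal 0 (q θ)) ν := fun θ => by
    have hθ : Measurable fun z : Λ → ℝ => θ ⬝ᵥ z := by unfold dotProduct; fun_prop
    refine ⟨hθ.aemeasurable, ?_⟩
    rw [hν, AEMeasurable.map_map_of_aemeasurable hθ.aemeasurable hZm]
    exact (hasLaw_dotProduct_solution hdisj hdom hβ hB hΦ hm0 hm t θ).map_eq
  have : IsGaussian ν := isGaussian_of_hasLaw_dotProduct hlaw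
  have : IsGaussian γ := isGaussian_of_hasLaw_dotProduct (hasLaw_dotProduct_pi (β⁻¹).toNNReal)
  -- The flow contracts, so `Real.toNNReal` truncates nothing in the variances and they add up
  -- exactly.
  have hmono : ∀ θ : Λ → ℝ, 0 ≤ θ ⬝ᵥ θ - E θ ⬝ᵥ E θ := fun θ => by
    have h := integral_dotProduct_linearFlow (dotProduct_killedLaplacian_comm hdisj) θ t
    have h0 : 0 ≤ ∫ s in (0 : ℝ)..t, linearFlow (-killedLaplacian Λ Δ) (t - s) θ ⬝ᵥ
        killedLaplacian Λ Δ (linearFlow (-killedLaplacian Λ Δ) (t - s) θ) :=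
      intervalIntegral.integral_nonneg t.coe_nonneg fun s _ => by
        rw [dotProduct_killedLaplacian hdisj]
        exact Finset.sum_nonneg fun k _ => mul_self_nonneg _
    rw [h] at h0
    linarith
  have hpos : ∀ θ : Λ → ℝ, 0 ≤ θ ⬝ᵥ θ := fun θ =>
    Finset.sum_nonneg fun x _ => mul_self_nonneg _
  have hq : ∀ θ, q θ + (E θ ⬝ᵥ E θ).toNNReal * (β⁻¹).toNNReal =
      (θ ⬝ᵥ θ).toNNReal * (β⁻¹).toNNReal := fun θ => by
    simp only [q]
    rw [← Real.toNNReal_mul (hpos _), ← Real.toNNReal_mul (hpos _), ← Real.toNNReal_add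
      (div_nonneg (hmono θ) hβ.le) (mul_nonneg (hpos _) (inv_nonneg.2 hβ.le))]
    congr 1
    rw [div_eq_mul_inv]
    ring
  have hstat := map_add_linear_eq_pi hlaw E hEsymm hq
  have hcongr : ∀ ω, Φ t ω = m t + (Φ t ω - m t) := fun ω => by abel
  have hcont : Continuous fun z : Λ → ℝ => dualityFn β Λ Δ σ (m t + z) η := by
    unfold dualityFn hermiteFn
    simp only [Pi.add_apply]
    fun_prop
  have hint2 : Integrable (fun p : (Λ → ℝ) × (Λ → ℝ) => monomialFn (fun x => η (.inl x))
      (toComplexPi (m t + p.1) + Complex.I • toComplexPi p.2)) (ν.prod γ) := by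
    exact integrable_monomialFn _ (memLp_toComplexPi_add_I_smul ν γ (m t))
  have hintν : Integrable (fun z => dualityFn β Λ Δ σ (m t + z) η) ν := by
    -- Averaging the monomial over the imaginary vector returns the real function `dualityFn`, so
    -- its integrability comes from Fubini.
    have h := (hint2.integral_prod_left.const_mul (∏ y, (σ y : ℂ) ^ η (.inr y))).re
    refine h.congr (ae_of_all _ fun z => ?_)
    simp only
    rw [← integral_const_mul]
    simp_rw [← monomialFn_sumElim η _ fun w => (σ w : ℂ)]
    rw [← dualityFn_eq_integral hβ]
    exact Complex.ofReal_re _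
  refine ⟨?_, ?_⟩
  · have h := (integrable_map_measure hcont.aestronglyMeasurable hZm).1 hintν
    refine h.congr (ae_of_all _ fun ω => ?_)
    simp only [Function.comp_apply]
    rw [← hcongr]
  · have hy := fun g : Λ → ℝ => dual_integral_monomialFn hX σ
      (y := fun s => toComplexPi (m s) + Complex.I •
        toComplexPi (linearFlow (-killedLaplacian Λ Δ) s g))
      (fun s x => hasDerivAt_complex_solution hm g s x) t
    simp only [hm0, linearFlow_zero] at hy
    have hintγ : ∀ ζ : DualConfig Λ Δ, Integrable (fun g : Λ → ℝ => monomialFn ζ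
        (Sum.elim (toComplexPi φ + Complex.I • toComplexPi g) fun w => (σ w : ℂ))) γ := by
      intro ζ
      simp_rw [monomialFn_sumElim]
      refine (integrable_monomialFn _ fun p => ?_).const_mul _
      exact (memLp_const (toComplexPi φ)).add ((memLp_toComplexPi γ p).const_smul Complex.I)
    apply Complex.ofReal_injective
    rw [← integral_complex_ofReal, ← integral_complex_ofReal]
    calc ∫ ω, (dualityFn β Λ Δ σ (Φ t ω) η : ℂ) ∂P
        = ∫ z, (dualityFn β Λ Δ σ (m t + z) η : ℂ) ∂ν := by
          rw [hν, integral_map hZm]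
          · simp_rw [← hcongr]
          · exact (Complex.continuous_ofReal.comp hcont).aestronglyMeasurable
      _ = (∏ y, (σ y : ℂ) ^ η (.inr y)) * ∫ z, ∫ g, monomialFn (fun x => η (.inl x))
            (toComplexPi (m t + z) + Complex.I • toComplexPi g) ∂γ ∂ν := by
          simp_rw [dualityFn_eq_integral hβ, monomialFn_sumElim, integral_const_mul]
          rfl
      _ = ∫ g, monomialFn η (Sum.elim (toComplexPi (m t) + Complex.I • toComplexPi (E g))
            fun w => (σ w : ℂ)) ∂γ := by
          rw [integral_integral_monomialFn ν γ
            (integral_id_eq_zero_of_hasLaw_dotProduct hlaw) E hstat]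
          simp_rw [monomialFn_sumElim, integral_const_mul]
      -- For each `g`, `m t + i E g` is the time-`t` value of the complex solution started at `φ + i
      -- g`, so the duality of the walkers applies. As the number of particles is fixed, the
      -- expectation is a finite sum and exchanges with the integral over `g`.
      _ = ∫ g, ∑ ζ ∈ configs Λ Δ (∑ v, η v), Q.real {ω | X t ω = ζ} • monomialFn ζ
            (Sum.elim (toComplexPi φ + Complex.I • toComplexPi g) fun w => (σ w : ℂ)) ∂γ := by
          congr 1
          ext g
          rw [← (dual_integral_eq_sum hX t _).2, hy]
      _ = ∑ ζ ∈ configs Λ Δ (∑ v, η v), Q.real {ω | X t ω = ζ} •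
            (dualityFn β Λ Δ σ φ ζ : ℂ) := by
          have hsm : ∀ ζ ∈ configs Λ Δ (∑ v, η v), Integrable (fun g : Λ → ℝ =>
              Q.real {ω | X t ω = ζ} • monomialFn ζ (Sum.elim (toComplexPi φ +
                Complex.I • toComplexPi g) fun w => (σ w : ℂ))) γ := fun ζ _ =>
            (hintγ ζ).smul (Q.real {ω | X t ω = ζ})
          rw [integral_finsetSum _ hsm]
          simp_rw [integral_smul, dualityFn_eq_integral hβ]
          rfl
      _ = ∫ ω, (dualityFn β Λ Δ σ φ (X t ω) : ℂ) ∂Q :=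
          (dual_integral_eq_sum hX t fun ζ => (dualityFn β Λ Δ σ φ ζ : ℂ)).2.symm

end Duality

lemma box_subset_domain (d n N : ℕ) [NeZero d] {x : Site d} (hx : x ∈ box d n N) :
    x ∈ domain d n := by
  classical
  exact (Finset.mem_filter.1 hx).2

end GinzburgLandau

theorem mainTheorem6 (d n N : ℕ) [NeZero d] (hnN : n < N)
    (Δ : Finset (GinzburgLandau.Site d)) (hΔ : Δ ⊆ GinzburgLandau.shell d n N)
    (σ : Δ → ℝ) (β : ℝ) (hβ : 0 < β)
    {Ω : Type*} [MeasurableSpace Ω] (P : Measure Ω) [IsProbabilityMeasure P]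
    (B : GinzburgLandau.Bond d n → ℝ≥0 → Ω → ℝ) (hB : GinzburgLandau.IsBondNoise P B)
    (φ : GinzburgLandau.box d n N → ℝ) (Φ : ℝ≥0 → Ω → GinzburgLandau.box d n N → ℝ)
    (hΦ : GinzburgLandau.IsSolution P β (GinzburgLandau.box d n N) Δ σ
      GinzburgLandau.quadraticH B φ Φ)
    {Ω' : Type*} [MeasurableSpace Ω'] (Q : Measure Ω') [IsProbabilityMeasure Q]
    (η : GinzburgLandau.DualConfig (GinzburgLandau.box d n N) Δ)
    (X : ℝ≥0 → Ω' → GinzburgLandau.DualConfig (GinzburgLandau.box d n N) Δ)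
    (hX : GinzburgLandau.IsMarkovJumpProcess Q
      (GinzburgLandau.dualGenerator (GinzburgLandau.box d n N) Δ) η X)
    (t : ℝ≥0) :
    Integrable (fun ω => GinzburgLandau.dualityFn β (GinzburgLandau.box d n N) Δ σ (Φ t ω) η) P ∧
    Integrable (fun ω => GinzburgLandau.dualityFn β (GinzburgLandau.box d n N) Δ σ φ (X t ω)) Q ∧
    ∫ ω, GinzburgLandau.dualityFn β (GinzburgLandau.box d n N) Δ σ (Φ t ω) η ∂P =
      ∫ ω, GinzburgLandau.dualityFn β (GinzburgLandau.box d n N) Δ σ φ (X t ω) ∂Q := by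
  have hΔ : Δ ⊆ GinzburgLandau.box d n (N + 1) \ GinzburgLandau.box d n N := hΔ
  have hdisj : Disjoint (GinzburgLandau.box d n N) Δ :=
    Finset.disjoint_right.2 fun _ hx => (Finset.mem_sdiff.1 (hΔ hx)).2
  have hdom : ∀ x ∈ GinzburgLandau.box d n N ∪ Δ, x ∈ GinzburgLandau.domain d n := fun x hx =>
    (Finset.mem_union.1 hx).elim (GinzburgLandau.box_subset_domain d n N) fun h =>
      GinzburgLandau.box_subset_domain d n (N + 1) (Finset.mem_sdiff.1 (hΔ h)).1
  have h := GinzburgLandau.duality hdisj hdom hβ hB hΦ hX t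
  exact ⟨h.1, (GinzburgLandau.dual_integral_eq_sum hX t _).1, h.2⟩
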